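/- Consider $L$ items, $K$ positions ($1\le K\le L$) and a horizon $n\ge 1$. In step $t\in\{1,\dots,n\}$ an agent shows a list $R_t$ of $K$ distinct items, the attraction indicators $A_t(a)\in\{0,1\}$ are independent (over all $t$ and $a$) Bernoulli variables with means $\alpha_t(a)$, and the agent observes the position $c_t$ of the first attractive item of $R_t$ ($c_t=K+1$ if there is none). An item of $R_t$ is observed in step $t$ if its position is at most $c_t$. Let $r(R,v)=1-\prod_{i=1}^K(1-v(R(i)))$, let $$R(n)=\sum_{t=1}^n\mathbb E\Big[\max_R r(R,\alpha_t)-r(R_t,A_t)\Big]$$ be the expected regret, where the maximum is over all lists of $K$ distinct items, and let $\Upsilon_n=|\{1\le t<n:\alpha_{t+1}\ne\alpha_t\}|$. For $\epsilon\in(1/2,1)$ and an integer window size $\tau\ge 2$, CascadeSWUCB shows in step $t$ a list of $K$ items with the largest values of $$U_t(a)=\frac{X_t(a)}{N_t(a)}+\sqrt{\frac{\epsilon\ln(\min(t,\tau))}{N_t(a)}},\qquad \frac x0:=1,$$ where $N_t(a)$ and $X_t(a)$ count how often $a$ was observed and clicked in the previous $\tau$ steps; ties and the order within the list are resolved by an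 arbitrary rule based on the past observations. Let $D_t^*$ be a set of $K$ items with the largest $\alpha_t$, and let $\Delta_{a,K}=\min\{\alpha_t(a^*)-\alpha_t(a): t\le n,\ a\notin D_t^*,\ a^*\in D_t^*\}$, with $1/\Delta_{a,K}:=0$ if $a\in D^*_t$ for all $t\le n$. Assume that $\Delta_{a,K}>0$ for all other items $a$. Write $\lambda=\ln\big(1+4\sqrt{1-1/(2\epsilon)}\big)$. (i) For every integer $\tau\ge2$, $$R(n)\le L\Upsilon_n\tau+\frac{L\ln^2\tau}{\lambda}+\sum_{a}C(\tau,a)\frac{n\ln\tau}{\tau},\qquad C(\tau,a)=\frac{2}{\ln\tau}\Big\lceil\frac{\ln\tau}{\lambda}\Big\rceil+\frac{8\epsilon}{\Delta_{a,K}}\,\frac{\lceil n/\tau\rceil}{n/\tau}.$$ (ii) If $\tau\to\infty$ and $n/\tau\to\infty$ while $1/\Delta_{a,K}$ stays fixed (or converges in $[0,\infty)$), then $C(\tau,a)$ converges to $\dfrac{2}{\lambda}+\dfrac{8\epsilon}{\Delta_{a,K}}$ (with the limit of $1/\Delta_{a,K}$). (iii) If $\Upsilon_n\ge1$ and $\tau=2\sqrt{n\ln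 n/\Upsilon_n}$, rounded up or down to an integer, then $R(n)=O\big(\sqrt{n\Upsilon_n\ln n}\big)$: for every $\delta>0$ there is a constant that depends only on $L,K,\epsilon,\delta$ such that the bound holds with this constant for all $n$ and all environments all of whose gaps $\alpha_t(a^*)-\alpha_t(a)$ ($t\le n$, $a\notin D_t^*$, $a^*\in D_t^*$) are at least $\delta$. -/

import Mathlib

open MeasureTheory ProbabilityTheory Filter Topology

namespace CascadeBandit

/-- Ranked lists: `K` distinct items out of `L`; `R i` is the item at position `i`
(positions are numbered from `0` to `K - 1`). -/
abbrev Ranking (L K : ℕ) := Fin K ↪ Fin L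

/-- The reward function `r(R, v) = 1 - ∏ᵢ (1 - v(R(i)))`. -/
noncomputable def reward {L K : ℕ} (R : Ranking L K) (v : Fin L → ℝ) : ℝ :=
  1 - ∏ i, (1 - v (R i))

/-- The click feedback of the cascade model: the first position that holds an attractive item,
and `K` (no click) if there is none. -/
def click {L K : ℕ} (R : Ranking L K) (x : Fin L → Bool) : ℕ :=
  Nat.find (p := fun i => ∀ h : i < K, x (R ⟨i, h⟩) = true) ⟨K, fun h => absurd h (lt_irrefl K)⟩

/-- What the agent has seen so far: the displayed lists with their clicks, most recent first. -/
abbrev History (L K : ℕ) := List (Ranking L K × ℕ)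

open scoped Classical in
/-- Number of times that item `a` was observed (displayed at or above the position of the click)
in the last `τ` rounds. -/
noncomputable def obsCount {L K : ℕ} (τ : ℕ) (h : History L K) (a : Fin L) : ℕ :=
  (h.take τ).countP (fun e => decide (∃ i : Fin K, e.1 i = a ∧ (i : ℕ) ≤ e.2))

open scoped Classical in
/-- Number of times that item `a` was clicked in the last `τ` rounds. -/
noncomputable def clickCount {L K : ℕ} (τ : ℕ) (h : History L K) (a : Fin L) : ℕ :=
  (h.take τ).countP (fun e => decide (∃ i : Fin K, e.1 i = a ∧ (i : ℕ) = e.2))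

/-- Division with the convention `x / 0 = 1`. -/
noncomputable def divOne (x : ℝ) (m : ℕ) : ℝ := if m = 0 then 1 else x / m

/-- The sliding-window upper confidence bound of item `a` in step `t = h.length + 1`:
the average observed attraction in the window plus `√(ε ln(t ∧ τ) / N)`. -/
noncomputable def ucb {L K : ℕ} (ε : ℝ) (τ : ℕ) (h : History L K) (a : Fin L) : ℝ :=
  divOne (clickCount τ h a) (obsCount τ h a)
    + √(divOne (ε * Real.log ((min (h.length + 1) τ : ℕ) : ℝ)) (obsCount τ h a))

/-- `σ` is a version of CascadeSWUCB: after every history it displays `K` items with the largest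
upper confidence bounds. Ties and the order within the list are resolved arbitrarily. -/
def IsCascadeSWUCB {L K : ℕ} (ε : ℝ) (τ : ℕ) (σ : History L K → Ranking L K) : Prop :=
  ∀ h : History L K, ∀ a ∈ Set.range (σ h), ∀ b ∉ Set.range (σ h), ucb ε τ h b ≤ ucb ε τ h a

/-- The history after `t` rounds, when the policy `σ` faces the attraction indicators
`x 0, x 1, …` (rounds are numbered from `0`). -/
def history {L K : ℕ} (σ : History L K → Ranking L K) (x : ℕ → Fin L → Bool) : ℕ → History L K
  | 0 => []
  | t + 1 => (σ (history σ x t), click (σ (history σ x t)) (x t)) :: history σ x t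

/-- The environment over `n` rounds: the attraction indicators `A t a` (item `a`, round `t < n`)
are independent Bernoulli variables with means `α t a`. -/
structure IsEnvironment {L : ℕ} {Ω : Type*} [MeasurableSpace Ω] (μ : Measure Ω) (n : ℕ)
    (α : ℕ → Fin L → ℝ) (A : ℕ → Fin L → Ω → Bool) : Prop where
  measurable : ∀ t < n, ∀ a, Measurable (A t a)
  indep : iIndepFun (fun p : Fin n × Fin L => A p.1 p.2) μ
  law : ∀ t < n, ∀ a, μ.real {ω | A t a ω = true} = α t a

/-- The expected `n`-step regret of the policy `σ`. -/
noncomputable def regret {L K : ℕ} {Ω : Type*} [MeasurableSpace Ω] (μ : Measure Ω)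
    (α : ℕ → Fin L → ℝ) (A : ℕ → Fin L → Ω → Bool) (σ : History L K → Ranking L K) (n : ℕ) : ℝ :=
  ∑ t ∈ Finset.range n, ∫ ω, ((⨆ R : Ranking L K, reward R (α t))
    - reward (σ (history σ (fun s a => A s a ω) t)) (fun a => if A t a ω = true then 1 else 0)) ∂μ

open scoped Classical in
/-- The number of changes of the attraction probabilities within the `n` rounds. -/
noncomputable def numChanges {L : ℕ} (α : ℕ → Fin L → ℝ) (n : ℕ) : ℕ :=
  ((Finset.range n).filter (fun t => t + 1 < n ∧ α (t + 1) ≠ α t)).card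

/-- `D t` is a set of `K` most attractive items in each of the `n` rounds. -/
def IsOptimalSets {L : ℕ} (K n : ℕ) (α : ℕ → Fin L → ℝ) (D : ℕ → Finset (Fin L)) : Prop :=
  ∀ t < n, (D t).card = K ∧ ∀ b ∈ D t, ∀ a ∉ D t, α t a ≤ α t b

/-- The smallest gap `Δ` between item `a` and an optimal item, over the rounds in which `a` is
suboptimal. -/
noncomputable def gap {L : ℕ} (α : ℕ → Fin L → ℝ) (D : ℕ → Finset (Fin L)) (n : ℕ) (a : Fin L) :
    ℝ :=
  sInf {x | ∃ t < n, a ∉ D t ∧ ∃ b ∈ D t, x = α t b - α t a}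

open scoped Classical in
/-- The reciprocal `1 / Δ` of the smallest gap; it is `0` for an item that is never suboptimal
(a minimum over the empty set is `+∞`). -/
noncomputable def invGap {L : ℕ} (α : ℕ → Fin L → ℝ) (D : ℕ → Finset (Fin L)) (n : ℕ)
    (a : Fin L) : ℝ :=
  if ∃ t < n, a ∉ D t then 1 / gap α D n a else 0

/-- `ln(1 + 4 √(1 - 1/(2ε)))`. -/
noncomputable def logEta (ε : ℝ) : ℝ := Real.log (1 + 4 * √(1 - 1 / (2 * ε)))

/-- The constant `C(τ, a)`, as a function of `n` and of the reciprocal gap `g = 1 / Δ` of `a`. -/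
noncomputable def swConst (ε : ℝ) (n τ : ℕ) (g : ℝ) : ℝ :=
  2 / Real.log τ * (⌈Real.log τ / logEta ε⌉ : ℝ)
    + 8 * ε * g * ((⌈(n : ℝ) / τ⌉ : ℝ) / ((n : ℝ) / τ))

end CascadeBandit

universe u

open CascadeBandit

/-! Conditionally on the past, an item that is observed has a Bernoulli attraction, so the centred
clicks of an item in a window with constant means give rise to an exponential supermartingale.
Peeling over geometric slices of the random number of observations, of which there are about
`ln T / λ` in a window of `T` rounds, bounds the probability that an item leaves its confidence
interval by `⌈ln T / λ⌉ / T`.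

Outside these events, and in rounds whose window contains no change point, replacing optimal items
by the displayed ones costs at most `∑ (probability that a is observed) * (width of the confidence
interval of a)`, the sum running over displayed suboptimal items. An item whose width exceeds its
gap `Δ` has been observed at most `4 ε ln τ / Δ²` times in the window, so each block of `τ` rounds
contributes at most `8 ε ln τ / Δ` by `∑ 1 / √s ≤ 2 √N`. A change point spoils at most `τ` windows.
-/

namespace CascadeBandit

section BernoulliWeight

variable {ι : Type*} [Fintype ι] {v : ι → ℝ}

/-- The probability that independent Bernoulli variables with means `v` take the values `y`. -/
noncomputable def bernoulliWeight (v : ι → ℝ) (y : ι → Bool) : ℝ :=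
  ∏ a, if y a = true then v a else 1 - v a

theorem bernoulliWeight_nonneg (hv : ∀ a, v a ∈ Set.Icc (0 : ℝ) 1) (y : ι → Bool) :
    0 ≤ bernoulliWeight v y := by
  refine Finset.prod_nonneg fun a _ ↦ ?_
  split_ifs
  · exact (hv a).1
  · exact sub_nonneg.2 (hv a).2

theorem sum_bernoulliWeight_mul_prod [DecidableEq ι] (v : ι → ℝ) (s : Finset ι)
    (g : ι → Bool → ℝ) :
    ∑ y, bernoulliWeight v y * ∏ a ∈ s, g a (y a)
      = ∏ a ∈ s, (v a * g a true + (1 - v a) * g a false) := by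
  let F : ι → Bool → ℝ := fun a b ↦
    (if b = true then v a else 1 - v a) * if a ∈ s then g a b else 1
  have hF : ∀ y, bernoulliWeight v y * ∏ a ∈ s, g a (y a) = ∏ a, F a (y a) := fun y ↦ by
    simp only [F, Finset.prod_mul_distrib, Finset.prod_ite_mem, Finset.univ_inter,
      bernoulliWeight]
  calc ∑ y, bernoulliWeight v y * ∏ a ∈ s, g a (y a)
      = ∏ a, ∑ b, F a b := by
        simp only [hF, Finset.prod_univ_sum, Fintype.piFinset_univ]
    _ = ∏ a, if a ∈ s then v a * g a true + (1 - v a) * g a false else 1 :=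
        Finset.prod_congr rfl fun a _ ↦ by by_cases ha : a ∈ s <;> simp [F, ha]
    _ = ∏ a ∈ s, (v a * g a true + (1 - v a) * g a false) := by
        rw [Finset.prod_ite_mem, Finset.univ_inter]

theorem sum_bernoulliWeight [DecidableEq ι] (v : ι → ℝ) : ∑ y, bernoulliWeight v y = 1 := by
  simpa using sum_bernoulliWeight_mul_prod v ∅ fun _ _ ↦ 1

end BernoulliWeight

variable {L K : ℕ}

section Click

variable (R : Ranking L K) (y : Fin L → Bool) (k : Fin K)

theorem le_click_iff : (k : ℕ) ≤ click R y ↔ ∀ i < k, y (R i) = false := by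
  rw [click, Nat.le_find_iff]
  refine ⟨fun h i hi ↦ ?_, fun h m hm hall ↦ ?_⟩
  · simpa [i.isLt] using h i hi
  · simpa [h ⟨m, hm.trans k.isLt⟩ hm] using hall (hm.trans k.isLt)

theorem eq_click_iff : (k : ℕ) = click R y ↔ (k : ℕ) ≤ click R y ∧ y (R k) = true := by
  refine ⟨fun h ↦ ⟨h.le, ?_⟩, fun h ↦ h.1.antisymm (Nat.find_min' _ fun _ ↦ h.2)⟩
  have hspec : ∀ h : click R y < K, y (R ⟨click R y, h⟩) = true :=
    Nat.find_spec (p := fun i ↦ ∀ h : i < K, y (R ⟨i, h⟩) = true) _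
  simpa [← h] using hspec

theorem sum_bernoulliWeight_mul_ite_le_click (v : Fin L → ℝ) (f : Bool → ℝ) :
    ∑ y, bernoulliWeight v y * (if (k : ℕ) ≤ click R y then f (y (R k)) else 0)
      = (∏ i ∈ Finset.Iio k, (1 - v (R i))) * (v (R k) * f true + (1 - v (R k)) * f false) := by
  let g : Fin L → Bool → ℝ := fun a b ↦ if a = R k then f b else if b = true then 0 else 1
  have hg : ∀ i ∈ Finset.Iio k, ∀ b, g (R i) b = if b = true then 0 else 1 := fun i hi b ↦
    if_neg (R.injective.ne (Finset.mem_Iio.1 hi).ne)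
  have hite : ∀ y : Fin L → Bool, (if (k : ℕ) ≤ click R y then f (y (R k)) else 0)
      = ∏ a ∈ (insert k (Finset.Iio k)).map R, g a (y a) := fun y ↦ by
    rw [Finset.prod_map, Finset.prod_insert (by simp),
      Finset.prod_congr rfl fun i hi ↦ hg i hi (y (R i))]
    simp only [g, if_true, le_click_iff]
    split_ifs with h
    · rw [Finset.prod_eq_one fun i hi ↦ by simp [h i (Finset.mem_Iio.1 hi)], mul_one]
    · obtain ⟨i, hi, hyi⟩ : ∃ i < k, y (R i) = true := by simpa using h
      rw [Finset.prod_eq_zero (Finset.mem_Iio.2 hi) (by simp [hyi]), mul_zero]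
  simp only [hite, sum_bernoulliWeight_mul_prod]
  rw [Finset.prod_map, Finset.prod_insert (by simp), mul_comm,
    Finset.prod_congr rfl fun i hi ↦ by rw [hg i hi true, hg i hi false]]
  simp [g]

end Click

section Reward

variable {v : Fin L → ℝ}

theorem sum_bernoulliWeight_mul_reward (v : Fin L → ℝ) (R : Ranking L K) :
    ∑ y, bernoulliWeight v y * reward R (fun a ↦ if y a = true then 1 else 0) = reward R v := by
  have h := sum_bernoulliWeight_mul_prod v (Finset.univ.map R)
    fun _ b ↦ 1 - if b = true then (1 : ℝ) else 0
  simp only [Finset.prod_map, if_true, sub_self, mul_zero, zero_add, Bool.false_eq_true, if_false,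
    sub_zero, mul_one] at h
  simp only [reward, mul_sub, Finset.sum_sub_distrib, mul_one, sum_bernoulliWeight, h]

theorem reward_nonneg (hv : ∀ a, v a ∈ Set.Icc (0 : ℝ) 1) (R : Ranking L K) :
    0 ≤ reward R v :=
  sub_nonneg.2 <| Finset.prod_le_one (fun i _ ↦ sub_nonneg.2 (hv (R i)).2)
    fun i _ ↦ sub_le_self 1 (hv (R i)).1

theorem reward_le_reward (hv : ∀ a, v a ∈ Set.Icc (0 : ℝ) 1) {R S : Ranking L K}
    (h : ∀ k, v (R k) ≤ v (S k)) : reward R v ≤ reward S v :=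
  sub_le_sub_left (Finset.prod_le_prod (fun k _ ↦ sub_nonneg.2 (hv (S k)).2)
    fun k _ ↦ sub_le_sub_left (h k) 1) 1

theorem reward_eq_of_map_eq {S : Ranking L K} {D : Finset (Fin L)} (h : Finset.univ.map S = D) :
    reward S v = 1 - ∏ a ∈ D, (1 - v a) := by
  rw [reward, ← h, Finset.prod_map]

theorem exists_map_eq_of_card_eq {ι β : Type*} [Fintype ι] (R : ι ↪ β) {D : Finset β}
    (hD : D.card = Fintype.card ι) :
    ∃ S : ι ↪ β, Finset.univ.map S = D ∧ ∀ k, R k ∈ D → S k = R k := by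
  classical
  obtain ⟨e, he⟩ := Finset.exists_equiv_extend_of_card_eq hD.symm (f := R)
    (s := {k | R k ∈ D}) (by simp [Finset.subset_iff]) R.injective.injOn
  refine ⟨e.toEmbedding.trans (Function.Embedding.subtype _), ?_, fun k hk ↦ by simp [he k, hk]⟩
  rw [← Finset.map_map, Finset.map_univ_equiv]
  exact Finset.attach_map_val

theorem le_of_map_eq {D : Finset (Fin L)} (hopt : ∀ b ∈ D, ∀ a ∉ D, v a ≤ v b)
    {R S : Ranking L K} (hS : Finset.univ.map S = D) (hSR : ∀ k, R k ∈ D → S k = R k)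
    (k : Fin K) : v (R k) ≤ v (S k) := by
  by_cases hk : R k ∈ D
  · rw [hSR k hk]
  · exact hopt _ (hS ▸ Finset.mem_map_of_mem S (Finset.mem_univ k)) _ hk

theorem iSup_reward_le (hv : ∀ a, v a ∈ Set.Icc (0 : ℝ) 1) {D : Finset (Fin L)}
    (hD : D.card = K) (hopt : ∀ b ∈ D, ∀ a ∉ D, v a ≤ v b) :
    ⨆ R : Ranking L K, reward R v ≤ 1 - ∏ a ∈ D, (1 - v a) := by
  refine Real.iSup_le (fun R ↦ ?_) (sub_nonneg.2 <| Finset.prod_le_one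
    (fun a _ ↦ sub_nonneg.2 (hv a).2) fun a _ ↦ sub_le_self 1 (hv a).1)
  obtain ⟨S, hS, hSR⟩ := exists_map_eq_of_card_eq R (by simpa using hD)
  rw [← reward_eq_of_map_eq hS]
  exact reward_le_reward hv (le_of_map_eq hopt hS hSR)

end Reward

section Loss

variable {v : Fin L → ℝ}

/-- The expected one-round regret of displaying `R` when the items have attraction
probabilities `v`. -/
noncomputable def loss (v : Fin L → ℝ) (R : Ranking L K) : ℝ :=
  (⨆ S : Ranking L K, reward S v) - reward R v

/-- Item `a` was observed in the round recorded by `e`: it is displayed at or above the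
position of the click. -/
def Observed (e : Ranking L K × ℕ) (a : Fin L) : Prop :=
  ∃ i : Fin K, e.1 i = a ∧ (i : ℕ) ≤ e.2

/-- Item `a` was clicked in the round recorded by `e`. -/
def Clicked (e : Ranking L K × ℕ) (a : Fin L) : Prop :=
  ∃ i : Fin K, e.1 i = a ∧ (i : ℕ) = e.2

/-- What the agent records when the list `R` meets the attraction indicators `y`. -/
def feedback (R : Ranking L K) (y : Fin L → Bool) : Ranking L K × ℕ :=
  (R, click R y)

theorem observed_feedback {R : Ranking L K} {y : Fin L → Bool} {k : Fin K} :
    Observed (feedback R y) (R k) ↔ (k : ℕ) ≤ click R y := by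
  simp [Observed, feedback]

theorem clicked_feedback {R : Ranking L K} {y : Fin L → Bool} {k : Fin K} :
    Clicked (feedback R y) (R k) ↔ (k : ℕ) ≤ click R y ∧ y (R k) = true := by
  simp [Clicked, feedback, ← eq_click_iff]

theorem Observed.mem_range {R : Ranking L K} {y : Fin L → Bool} {a : Fin L}
    (h : Observed (feedback R y) a) : a ∈ Set.range R :=
  h.imp fun _ ↦ And.left

open scoped Classical in
/-- The probability that item `a` is observed in a round in which `R` is displayed and the items
have attraction probabilities `v`. -/
noncomputable def obsProb (v : Fin L → ℝ) (R : Ranking L K) (a : Fin L) : ℝ :=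
  ∑ y, bernoulliWeight v y * if Observed (feedback R y) a then 1 else 0

theorem obsProb_nonneg (hv : ∀ a, v a ∈ Set.Icc (0 : ℝ) 1) (R : Ranking L K) (a : Fin L) :
    0 ≤ obsProb v R a :=
  Finset.sum_nonneg fun y _ ↦ mul_nonneg (bernoulliWeight_nonneg hv y) (by split_ifs <;> norm_num)

theorem obsProb_apply (v : Fin L → ℝ) (R : Ranking L K) (k : Fin K) :
    obsProb v R (R k) = ∏ i ∈ Finset.Iio k, (1 - v (R i)) := by
  simpa [obsProb, observed_feedback] using
    sum_bernoulliWeight_mul_ite_le_click R k v fun _ ↦ 1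

theorem obsProb_eq_zero {R : Ranking L K} {a : Fin L} (ha : a ∉ Set.range R) :
    obsProb v R a = 0 :=
  Finset.sum_eq_zero fun y _ ↦ by rw [if_neg fun h ↦ ha h.mem_range, mul_zero]

theorem prod_sub_prod_le {ι : Type*} [Fintype ι] [LinearOrder ι] [LocallyFiniteOrderBot ι]
    {f g : ι → ℝ} (hg : ∀ i, 0 ≤ g i) (hgf : ∀ i, g i ≤ f i) (hf : ∀ i, f i ≤ 1) :
    ∏ i, f i - ∏ i, g i ≤ ∑ k, (∏ i ∈ Finset.Iio k, f i) * (f k - g k) := by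
  have h := Finset.prod_add_ordered Finset.univ g fun i ↦ f i - g i
  simp only [add_sub_cancel] at h
  rw [h, add_sub_cancel_left]
  refine Finset.sum_le_sum fun k _ ↦ ?_
  have hIio : ({j | j < k} : Finset ι) = Finset.Iio k := by ext; simp
  rw [hIio, mul_comm (f k - g k)]
  refine mul_le_of_le_one_right (mul_nonneg ?_ (sub_nonneg.2 (hgf k)))
    (Finset.prod_le_one (fun i _ ↦ hg i) fun i _ ↦ (hgf i).trans (hf i))
  exact Finset.prod_nonneg fun i _ ↦ (hg i).trans (hgf i)

theorem loss_le_sum_position (hv : ∀ a, v a ∈ Set.Icc (0 : ℝ) 1) {D : Finset (Fin L)}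
    (hD : D.card = K) (hopt : ∀ b ∈ D, ∀ a ∉ D, v a ≤ v b) (R : Ranking L K) {φ : Fin L → ℝ}
    (hφ : ∀ a ∈ Set.range R, a ∉ D → ∀ b ∈ D, b ∉ Set.range R → v b - v a ≤ φ a) :
    loss v R ≤ ∑ k with R k ∉ D, (∏ i ∈ Finset.Iio k, (1 - v (R i))) * φ (R k) := by
  obtain ⟨S, hS, hSR⟩ := exists_map_eq_of_card_eq R (by simpa using hD)
  have hle := le_of_map_eq hopt hS hSR
  have hSD : ∀ k, S k ∈ D := fun k ↦ hS ▸ Finset.mem_map_of_mem S (Finset.mem_univ k)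
  have hloss : loss v R ≤ ∏ i, (1 - v (R i)) - ∏ i, (1 - v (S i)) := by
    have h := iSup_reward_le hv hD hopt
    rw [← reward_eq_of_map_eq hS] at h
    simp only [loss, reward] at h ⊢
    linarith
  refine hloss.trans <| (prod_sub_prod_le (fun i ↦ sub_nonneg.2 (hv (S i)).2)
    (fun i ↦ sub_le_sub_left (hle i) 1) fun i ↦ sub_le_self 1 (hv (R i)).1).trans ?_
  rw [Finset.sum_filter]
  refine Finset.sum_le_sum fun k _ ↦ ?_
  by_cases hk : R k ∈ D
  · rw [hSR k hk, sub_self, mul_zero, if_neg (not_not.2 hk)]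
  · have hSk : S k ∉ Set.range R := by
      rintro ⟨j, hj⟩
      have hjD : R j ∈ D := hj ▸ hSD k
      exact hk (S.injective ((hSR j hjD).trans hj) ▸ hjD)
    rw [if_pos hk]
    refine mul_le_mul_of_nonneg_left ?_
      (Finset.prod_nonneg fun i _ ↦ sub_nonneg.2 (hv (R i)).2)
    linarith [hφ (R k) ⟨k, rfl⟩ hk (S k) (hSD k) hSk]

theorem loss_le_sum_obsProb (hv : ∀ a, v a ∈ Set.Icc (0 : ℝ) 1) {D : Finset (Fin L)}
    (hD : D.card = K) (hopt : ∀ b ∈ D, ∀ a ∉ D, v a ≤ v b) (R : Ranking L K) {φ : Fin L → ℝ}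
    (hφ : ∀ a ∈ Set.range R, a ∉ D → ∀ b ∈ D, b ∉ Set.range R → v b - v a ≤ φ a) :
    loss v R ≤ ∑ a with a ∉ D, obsProb v R a * φ a := by
  calc loss v R
      ≤ ∑ k with R k ∉ D, (∏ i ∈ Finset.Iio k, (1 - v (R i))) * φ (R k) :=
        loss_le_sum_position hv hD hopt R hφ
    _ = ∑ a ∈ ({k | R k ∉ D} : Finset (Fin K)).map R, obsProb v R a * φ a := by
        simp only [Finset.sum_map, obsProb_apply]
    _ = ∑ a with a ∉ D, obsProb v R a * φ a := by
        refine Finset.sum_subset (by simp [Finset.subset_iff]) fun a ha hmem ↦ ?_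
        rw [obsProb_eq_zero, zero_mul]
        rintro ⟨k, rfl⟩
        exact hmem (Finset.mem_map_of_mem R (by simpa using ha))

theorem loss_le_one (hv : ∀ a, v a ∈ Set.Icc (0 : ℝ) 1) (R : Ranking L K) : loss v R ≤ 1 := by
  have hsup : ⨆ S : Ranking L K, reward S v ≤ 1 := Real.iSup_le
    (fun S ↦ sub_le_self 1 (Finset.prod_nonneg fun i _ ↦ sub_nonneg.2 (hv (S i)).2)) zero_le_one
  exact (sub_le_self _ (reward_nonneg hv R)).trans hsup

end Loss

section Expectation

variable {Ω : Type*} [MeasurableSpace Ω] {μ : Measure Ω}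

theorem integrable_comp_of_finite [IsFiniteMeasure μ] {β : Type*} [Finite β] [MeasurableSpace β]
    [DiscreteMeasurableSpace β] {X : Ω → β} (hX : Measurable X) (F : β → ℝ) :
    Integrable (fun ω ↦ F (X ω)) μ :=
  Integrable.of_finite.comp_measurable hX

theorem integral_comp_of_indepFun [IsFiniteMeasure μ] {β γ : Type*}
    [Finite β] [MeasurableSpace β] [DiscreteMeasurableSpace β]
    [Fintype γ] [MeasurableSpace γ] [DiscreteMeasurableSpace γ]
    {X : Ω → β} {Y : Ω → γ} (hX : Measurable X) (hY : Measurable Y) (h : IndepFun X Y μ)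
    (G : β → γ → ℝ) :
    ∫ ω, G (X ω) (Y ω) ∂μ = ∫ ω, ∑ y, μ.real (Y ⁻¹' {y}) * G (X ω) y ∂μ := by
  have hmap := (indepFun_iff_map_prod_eq_prod_map_map hX.aemeasurable hY.aemeasurable).1 h
  have hG : AEStronglyMeasurable (fun p : β × γ ↦ G p.1 p.2) (μ.map fun ω ↦ (X ω, Y ω)) :=
    Measurable.of_discrete.aestronglyMeasurable
  rw [← integral_map (hX.prodMk hY).aemeasurable hG, hmap, integral_prod _ Integrable.of_finite,
    integral_map hX.aemeasurable Measurable.of_discrete.aestronglyMeasurable]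
  refine integral_congr_ae (ae_of_all _ fun ω ↦ ?_)
  simp only [integral_fintype Integrable.of_finite, smul_eq_mul,
    map_measureReal_apply hY (measurableSet_singleton _)]

/-- The attraction indicators of round `t`. -/
abbrev row (A : ℕ → Fin L → Ω → Bool) (t : ℕ) (ω : Ω) : Fin L → Bool :=
  fun a ↦ A t a ω

/-- The history of the first `t` rounds as a random variable. -/
abbrev randomHistory (σ : History L K → Ranking L K) (A : ℕ → Fin L → Ω → Bool) (t : ℕ) (ω : Ω) :
    History L K :=
  history σ (fun s a ↦ A s a ω) t

theorem length_history (σ : History L K → Ranking L K) (x : ℕ → Fin L → Bool) (t : ℕ) :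
    (history σ x t).length = t := by
  induction t with
  | zero => rfl
  | succ t ih => rw [history, List.length_cons, ih]

theorem history_congr (σ : History L K → Ranking L K) {x y : ℕ → Fin L → Bool} {t : ℕ}
    (h : ∀ s < t, x s = y s) : history σ x t = history σ y t := by
  induction t with
  | zero => rfl
  | succ t ih =>
    simp only [history, ih fun s hs ↦ h s (hs.trans t.lt_succ_self), h t t.lt_succ_self]

/-- The indices of the attraction indicators of the rounds before `t`. -/
def pastIndices (L n t : ℕ) : Finset (Fin n × Fin L) := {p | (p.1 : ℕ) < t}

theorem exists_history_eq_comp (σ : History L K → Ranking L K) {n t : ℕ} (ht : t ≤ n) :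
    ∃ G : (pastIndices L n t → Bool) → History L K,
      ∀ x, history σ x t = G fun p ↦ x p.1.1 p.1.2 := by
  let restrict (x : ℕ → Fin L → Bool) (p : pastIndices L n t) : Bool := x p.1.1 p.1.2
  have hfact : Function.FactorsThrough (fun x ↦ history σ x t) restrict := fun x y hxy ↦
    history_congr σ fun s hs ↦ funext fun a ↦
      congrFun hxy ⟨(⟨s, hs.trans_le ht⟩, a), by simp [pastIndices, hs]⟩
  exact ⟨_, fun x ↦ (hfact.extend_apply (fun _ ↦ []) x).symm⟩

namespace IsEnvironment

variable {n t : ℕ} {α : ℕ → Fin L → ℝ} {A : ℕ → Fin L → Ω → Bool}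

theorem measurable_row (hA : IsEnvironment μ n α A) (ht : t < n) : Measurable (row A t) :=
  measurable_pi_lambda _ fun a ↦ hA.measurable t ht a

theorem measurable_past (hA : IsEnvironment μ n α A) (t : ℕ) :
    Measurable fun ω (p : pastIndices L n t) ↦ A p.1.1 p.1.2 ω :=
  measurable_pi_lambda _ fun p ↦ hA.measurable _ p.1.1.2 _

theorem indepFun_past_row (hA : IsEnvironment μ n α A) (ht : t < n) :
    IndepFun (fun ω (p : pastIndices L n t) ↦ A p.1.1 p.1.2 ω) (row A t) μ := by
  let present : Finset (Fin n × Fin L) := {p | (p.1 : ℕ) = t}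
  have hdisj : Disjoint (pastIndices L n t) present :=
    Finset.disjoint_filter.2 fun p _ hp ↦ hp.ne
  exact (hA.indep.indepFun_finset _ _ hdisj fun p ↦ hA.measurable _ p.1.2 _).comp
    (φ := id) (ψ := fun z a ↦ z ⟨(⟨t, ht⟩, a), by simp [present]⟩)
    measurable_id Measurable.of_discrete

section IsProbabilityMeasure

variable [IsProbabilityMeasure μ]

theorem mem_Icc (hA : IsEnvironment μ n α A) (ht : t < n) (a : Fin L) :
    α t a ∈ Set.Icc (0 : ℝ) 1 :=
  hA.law t ht a ▸ ⟨measureReal_nonneg, measureReal_le_one⟩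

theorem measureReal_eq (hA : IsEnvironment μ n α A) (ht : t < n) (a : Fin L) (b : Bool) :
    μ.real (A t a ⁻¹' {b}) = if b = true then α t a else 1 - α t a := by
  have hmeas := hA.measurable t ht a (measurableSet_singleton true)
  cases b
  · rw [if_neg Bool.false_ne_true, ← hA.law t ht a]
    have hcompl : A t a ⁻¹' {false} = (A t a ⁻¹' {true})ᶜ := by ext ω; simp
    rw [hcompl, probReal_compl_eq_one_sub hmeas]
    rfl
  · rw [if_pos rfl, ← hA.law t ht a]
    rfl

theorem measureReal_row_eq (hA : IsEnvironment μ n α A) (ht : t < n) (y : Fin L → Bool) :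
    μ.real (row A t ⁻¹' {y}) = bernoulliWeight (α t) y := by
  have hindep := hA.indep.precomp (g := fun a : Fin L ↦ ((⟨t, ht⟩ : Fin n), a))
    (Prod.mk_right_injective _)
  have hinter : row A t ⁻¹' {y} = ⋂ a ∈ (Finset.univ : Finset (Fin L)), A t a ⁻¹' {y a} := by
    ext ω; simp [funext_iff]
  have hprod := hindep.measure_inter_preimage_eq_mul Finset.univ (sets := fun a ↦ {y a})
    fun a _ ↦ measurableSet_singleton _
  rw [measureReal_def, hinter, hprod, ENNReal.toReal_prod]
  exact Finset.prod_congr rfl fun a _ ↦ hA.measureReal_eq ht a (y a)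

theorem integrable_history (hA : IsEnvironment μ n α A) (σ : History L K → Ranking L K)
    (ht : t ≤ n) (F : History L K → ℝ) : Integrable (fun ω ↦ F (randomHistory σ A t ω)) μ := by
  obtain ⟨G, hG⟩ := exists_history_eq_comp σ ht
  simp only [hG]
  exact integrable_comp_of_finite (hA.measurable_past t) fun z ↦ F (G z)

theorem integrable_history_row (hA : IsEnvironment μ n α A) (σ : History L K → Ranking L K)
    (ht : t < n) (F : History L K → (Fin L → Bool) → ℝ) :
    Integrable (fun ω ↦ F (randomHistory σ A t ω) (row A t ω)) μ := by
  obtain ⟨G, hG⟩ := exists_history_eq_comp σ ht.le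
  simp only [hG]
  exact integrable_comp_of_finite ((hA.measurable_past t).prodMk (hA.measurable_row ht))
    fun z ↦ F (G z.1) z.2

theorem integral_history_row (hA : IsEnvironment μ n α A) (σ : History L K → Ranking L K)
    (ht : t < n) (F : History L K → (Fin L → Bool) → ℝ) :
    ∫ ω, F (randomHistory σ A t ω) (row A t ω) ∂μ
      = ∫ ω, ∑ y, bernoulliWeight (α t) y * F (randomHistory σ A t ω) y ∂μ := by
  obtain ⟨G, hG⟩ := exists_history_eq_comp σ ht.le
  simp only [hG, ← hA.measureReal_row_eq ht]
  exact integral_comp_of_indepFun (hA.measurable_past t) (hA.measurable_row ht)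
    (hA.indepFun_past_row ht) fun z y ↦ F (G z) y

end IsProbabilityMeasure

end IsEnvironment

end Expectation

section Counts

open scoped Classical in
theorem obsCount_cons (m : ℕ) (e : Ranking L K × ℕ) (h : History L K) (a : Fin L) :
    obsCount (m + 1) (e :: h) a = obsCount m h a + if Observed e a then 1 else 0 := by
  simp only [obsCount, List.take_succ_cons, List.countP_cons, decide_eq_true_eq, Observed]
  congr

open scoped Classical in
theorem clickCount_cons (m : ℕ) (e : Ranking L K × ℕ) (h : History L K) (a : Fin L) :
    clickCount (m + 1) (e :: h) a = clickCount m h a + if Clicked e a then 1 else 0 := by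
  simp only [clickCount, List.take_succ_cons, List.countP_cons, decide_eq_true_eq, Clicked]
  congr

theorem obsCount_min_length (τ : ℕ) (h : History L K) (a : Fin L) :
    obsCount (min h.length τ) h a = obsCount τ h a := by
  rw [obsCount, obsCount, min_comm, ← List.take_take, List.take_length]

theorem clickCount_min_length (τ : ℕ) (h : History L K) (a : Fin L) :
    clickCount (min h.length τ) h a = clickCount τ h a := by
  rw [clickCount, clickCount, min_comm, ← List.take_take, List.take_length]

theorem obsCount_mono {m τ : ℕ} (hm : m ≤ τ) (h : History L K) (a : Fin L) :
    obsCount m h a ≤ obsCount τ h a :=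
  (List.take_prefix_take_left hm).sublist.countP_le

theorem obsCount_le (m : ℕ) (h : History L K) (a : Fin L) : obsCount m h a ≤ m :=
  List.countP_le_length.trans (List.length_take_le _ _)

end Counts

section Supermartingale

theorem hoeffding_bernoulli {p : ℝ} (hp : p ∈ Set.Icc (0 : ℝ) 1) (θ : ℝ) :
    p * Real.exp (θ * (1 - p) - θ ^ 2 / 8) + (1 - p) * Real.exp (θ * (0 - p) - θ ^ 2 / 8) ≤ 1 := by
  let ν : Measure Bool := bernoulliMeasure true false ⟨p, hp⟩
  have hint : ∀ f : Bool → ℝ, ∫ b, f b ∂ν = p * f true + (1 - p) * f false := fun f ↦ by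
    simp [ν, integral_fintype Integrable.of_finite, bernoulliMeasure_real_apply]
  have hmgf := (hasSubgaussianMGF_of_mem_Icc (μ := ν) (a := 0) (b := 1)
    (X := fun b ↦ if b = true then 1 else 0) Measurable.of_discrete.aemeasurable
    (ae_of_all _ fun b ↦ by cases b <;> simp)).mgf_le θ
  have hvar : (((‖(1 : ℝ) - 0‖₊ / 2) ^ 2 : NNReal) : ℝ) * θ ^ 2 / 2 = θ ^ 2 / 8 := by
    simp only [sub_zero, nnnorm_one, NNReal.coe_pow, NNReal.coe_div, NNReal.coe_one,
      NNReal.coe_ofNat]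
    ring
  simp only [mgf, hint, if_true, Bool.false_eq_true, if_false, mul_one, mul_zero, add_zero,
    hvar] at hmgf
  rwa [Real.exp_sub, Real.exp_sub, ← mul_div_assoc, ← mul_div_assoc, ← add_div,
    div_le_one (Real.exp_pos _)]

/-- The exponential supermartingale of item `a`: the exponential of `θ` times the clicks centred
at `p` per observation, compensated by Hoeffding's bound, over the last `m` rounds. -/
noncomputable def expDev (θ p : ℝ) (a : Fin L) (m : ℕ) (h : History L K) : ℝ :=
  Real.exp (θ * (clickCount m h a - p * obsCount m h a) - θ ^ 2 / 8 * obsCount m h a)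

open scoped Classical in
/-- The factor by which one more round `e` multiplies `expDev`. -/
noncomputable def expDevFactor (θ p : ℝ) (a : Fin L) (e : Ranking L K × ℕ) : ℝ :=
  Real.exp (θ * ((if Clicked e a then 1 else 0) - p * (if Observed e a then 1 else 0))
    - θ ^ 2 / 8 * (if Observed e a then 1 else 0))

theorem expDev_cons (θ p : ℝ) (a : Fin L) (m : ℕ) (e : Ranking L K × ℕ) (h : History L K) :
    expDev θ p a (m + 1) (e :: h) = expDev θ p a m h * expDevFactor θ p a e := by
  rw [expDev, expDev, expDevFactor, ← Real.exp_add, obsCount_cons, clickCount_cons]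
  congr 1
  push_cast
  ring

theorem expDevFactor_feedback (θ p : ℝ) (R : Ranking L K) (y : Fin L → Bool) (k : Fin K) :
    expDevFactor θ p (R k) (feedback R y) = 1 + if (k : ℕ) ≤ click R y then
      Real.exp (θ * ((if y (R k) = true then 1 else 0) - p) - θ ^ 2 / 8) - 1 else 0 := by
  rw [expDevFactor, observed_feedback, clicked_feedback]
  by_cases hk : (k : ℕ) ≤ click R y <;> simp [hk]

theorem expDevFactor_feedback_of_notMem (θ p : ℝ) {R : Ranking L K} (y : Fin L → Bool)
    {a : Fin L} (ha : a ∉ Set.range R) : expDevFactor θ p a (feedback R y) = 1 := by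
  have hobs : ¬ Observed (feedback R y) a := fun h ↦ ha h.mem_range
  have hclick : ¬ Clicked (feedback R y) a := fun h ↦ hobs (h.imp fun _ hi ↦ ⟨hi.1, hi.2.le⟩)
  simp [expDevFactor, hobs, hclick]

theorem sum_bernoulliWeight_mul_expDevFactor_le {v : Fin L → ℝ}
    (hv : ∀ a, v a ∈ Set.Icc (0 : ℝ) 1) (θ : ℝ) (R : Ranking L K) (a : Fin L) :
    ∑ y, bernoulliWeight v y * expDevFactor θ (v a) a (feedback R y) ≤ 1 := by
  by_cases ha : a ∈ Set.range R
  · obtain ⟨k, rfl⟩ := ha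
    simp only [expDevFactor_feedback, mul_add, mul_one, Finset.sum_add_distrib,
      sum_bernoulliWeight]
    rw [sum_bernoulliWeight_mul_ite_le_click R k v fun b ↦
      Real.exp (θ * ((if b = true then 1 else 0) - v (R k)) - θ ^ 2 / 8) - 1]
    have hhoeffding := hoeffding_bernoulli (hv (R k)) θ
    refine add_le_of_nonpos_right (mul_nonpos_of_nonneg_of_nonpos
      (Finset.prod_nonneg fun i _ ↦ sub_nonneg.2 (hv (R i)).2) ?_)
    simp only [if_true, Bool.false_eq_true, if_false]
    linarith
  · simp [expDevFactor_feedback_of_notMem _ _ _ ha, sum_bernoulliWeight]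

theorem IsEnvironment.integral_expDev_le_one {Ω : Type*} [MeasurableSpace Ω] {μ : Measure Ω}
    [IsProbabilityMeasure μ] {n : ℕ} {α : ℕ → Fin L → ℝ} {A : ℕ → Fin L → Ω → Bool}
    (hA : IsEnvironment μ n α A) (σ : History L K → Ranking L K) (θ p : ℝ) (a : Fin L) {m t : ℕ}
    (hmt : m ≤ t) (ht : t ≤ n) (hp : ∀ s < t, t ≤ s + m → α s a = p) :
    ∫ ω, expDev θ p a m (randomHistory σ A t ω) ∂μ ≤ 1 := by
  induction m generalizing t with
  | zero => simp [expDev, obsCount, clickCount]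
  | succ m ih =>
    obtain ⟨t, rfl⟩ : ∃ s, t = s + 1 := ⟨t - 1, by omega⟩
    have hpt : α t a = p := hp t (by omega) (by omega)
    let next (h : History L K) (y : Fin L → Bool) : ℝ :=
      expDev θ p a (m + 1) (feedback (σ h) y :: h)
    calc ∫ ω, next (randomHistory σ A t ω) (row A t ω) ∂μ
        = ∫ ω, ∑ y, bernoulliWeight (α t) y * next (randomHistory σ A t ω) y ∂μ :=
          hA.integral_history_row σ ht next
      _ ≤ ∫ ω, expDev θ p a m (randomHistory σ A t ω) ∂μ := by
          refine integral_mono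
            (hA.integrable_history σ (by omega) fun h ↦ ∑ y, bernoulliWeight (α t) y * next h y)
            (hA.integrable_history σ (by omega) (expDev θ p a m)) fun ω ↦ ?_
          simp only [next, expDev_cons, mul_left_comm (bernoulliWeight _ _), ← Finset.mul_sum]
          refine mul_le_of_le_one_right (Real.exp_pos _).le ?_
          exact hpt ▸ sum_bernoulliWeight_mul_expDevFactor_le (hA.mem_Icc ht) θ _ a
      _ ≤ 1 := ih (by omega) (by omega) fun s hs hs' ↦ hp s (by omega) (by omega)

end Supermartingale

section Peeling

theorem logEta_pos {ε : ℝ} (hε : 1 / 2 < ε) : 0 < logEta ε := by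
  have hlt : 1 / (2 * ε) < 1 := (div_lt_one (by linarith)).2 (by linarith)
  have hsqrt : 0 < √(1 - 1 / (2 * ε)) := Real.sqrt_pos.2 (sub_pos.2 hlt)
  exact Real.log_pos (by linarith)

theorem exp_logEta (ε : ℝ) : Real.exp (logEta ε) = 1 + 4 * √(1 - 1 / (2 * ε)) :=
  Real.exp_log (by positivity)

theorem logEta_le_two {ε : ℝ} (hε : 1 / 2 < ε) : logEta ε ≤ 2 := by
  have hsqrt : √(1 - 1 / (2 * ε)) ≤ 1 :=
    Real.sqrt_le_one.2 (sub_le_self 1 (one_div_nonneg.2 (by linarith)))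
  have hexp : (5 : ℝ) ≤ Real.exp 2 := by
    linarith [Real.quadratic_le_exp_of_nonneg (show (0 : ℝ) ≤ 2 by norm_num)]
  rw [← Real.exp_le_exp, exp_logEta]
  linarith

/-- The parameter `θ` of the exponential supermartingale that is tuned to the `k`-th slice, in
which the number of observations lies between `exp (k * l)` and `exp ((k + 1) * l)`: it is the
minimiser `4 * δ / √N` of `θ ^ 2 * N / 8 - θ * δ * √N` at the geometric mean `N` of these bounds. -/
noncomputable def sliceParam (δ l : ℝ) (k : ℕ) : ℝ := 4 * δ * Real.exp (-((k + 1 / 2) * l) / 2)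

theorem abs_one_sub_exp_le (z : ℝ) : |1 - Real.exp z| ≤ Real.exp |z| - 1 := by
  rcases le_total 0 z with hz | hz
  · rw [abs_of_nonneg hz, abs_sub_comm, abs_of_nonneg (sub_nonneg.2 (Real.one_le_exp hz))]
  · rw [abs_of_nonpos hz, abs_of_nonneg (sub_nonneg.2 (Real.exp_le_one_iff.2 hz))]
    linarith [Real.one_le_cosh z, Real.cosh_eq z]

theorem abs_one_sub_exp_le_of_abs_le {z l : ℝ} (hz : |z| ≤ l / 4) :
    |1 - Real.exp z| ≤ (Real.exp l - 1) / 4 := by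
  have hquarter : Real.exp (l / 4) ≤ 1 + 1 / 4 * (Real.exp l - 1) := by
    have h := rpow_one_add_le_one_add_mul_self (s := Real.exp l - 1)
      (by linarith [Real.exp_pos l]) (show (0 : ℝ) ≤ 1 / 4 by norm_num) (by norm_num)
    rwa [add_sub_cancel, ← Real.exp_mul, mul_one_div] at h
  linarith [abs_one_sub_exp_le z, Real.exp_le_exp.2 hz]

theorem sliceParam_exponent {δ l N x : ℝ} {k : ℕ} (hδ : 0 ≤ δ) (hN : 0 < N)
    (hslice : |Real.log N - (k + 1 / 2) * l| ≤ l / 2) (hx : δ * √N ≤ x) :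
    2 * δ ^ 2 * (1 - ((Real.exp l - 1) / 4) ^ 2)
      ≤ sliceParam δ l k * x - sliceParam δ l k ^ 2 / 8 * N := by
  let e := Real.exp (-((k + 1 / 2) * l) / 2)
  let z := (Real.log N - (k + 1 / 2) * l) / 2
  have hexp : √N * e = Real.exp z := by
    rw [← Real.exp_log (Real.sqrt_pos.2 hN), Real.log_sqrt hN.le, ← Real.exp_add]
    congr 1
    ring
  have hz : |z| ≤ l / 4 := by
    rw [abs_div, abs_of_pos (zero_lt_two' ℝ)]
    linarith
  have hsq : (1 - Real.exp z) ^ 2 ≤ ((Real.exp l - 1) / 4) ^ 2 := by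
    rw [← sq_abs]
    exact pow_le_pow_left₀ (abs_nonneg _) (abs_one_sub_exp_le_of_abs_le hz) 2
  calc 2 * δ ^ 2 * (1 - ((Real.exp l - 1) / 4) ^ 2)
      ≤ 2 * δ ^ 2 * (1 - (1 - Real.exp z) ^ 2) := by gcongr
    _ = 4 * δ * e * (δ * √N) - (4 * δ * e) ^ 2 / 8 * √N ^ 2 := by rw [← hexp]; ring
    _ ≤ 4 * δ * e * x - (4 * δ * e) ^ 2 / 8 * N := by
        rw [Real.sq_sqrt hN.le]
        gcongr

theorem exists_nat_abs_sub_le {x y l : ℝ} (hx : 0 ≤ x) (hxy : x ≤ y) (hy : 0 < y) (hl : 0 < l) :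
    ∃ k < ⌈y / l⌉₊, |x - (k + 1 / 2) * l| ≤ l / 2 := by
  have hceil : ⌈x / l⌉₊ ≤ ⌈y / l⌉₊ := Nat.ceil_mono (by gcongr)
  have hpos : 0 < ⌈y / l⌉₊ := Nat.ceil_pos.2 (div_pos hy hl)
  refine ⟨⌈x / l⌉₊ - 1, by omega, abs_le.2 ?_⟩
  have hle : x ≤ ⌈x / l⌉₊ * l := (div_le_iff₀ hl).1 (Nat.le_ceil _)
  rcases Nat.eq_zero_or_pos ⌈x / l⌉₊ with h0 | h0
  · rw [h0] at hle ⊢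
    norm_num at hle ⊢
    constructor <;> linarith
  · have hlt : (⌈x / l⌉₊ - 1 : ℕ) * l < x := (lt_div_iff₀ hl).1 (Nat.lt_ceil.1 (by omega))
    rw [Nat.cast_pred h0] at hlt ⊢
    constructor <;> linarith

/-- The quantity `t ∧ τ` that enters the confidence radius in round `t = h.length + 1`. -/
def effWindow (τ : ℕ) (h : History L K) : ℕ := min (h.length + 1) τ

/-- The average of the observed indicators of `a` deviates from `p` in direction `s = ±1` by at
least the confidence radius. The inequality is multiplied by the number of observations. -/
def Deviates (ε : ℝ) (τ : ℕ) (s p : ℝ) (a : Fin L) (h : History L K) : Prop :=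
  1 ≤ obsCount τ h a ∧
    √(ε * Real.log (effWindow τ h)) * √(obsCount τ h a)
      ≤ s * (clickCount τ h a - p * obsCount τ h a)

theorem two_mul_sq_sqrt_mul_log {ε T : ℝ} (hε : 1 / 2 < ε) (hT : 1 ≤ T) :
    2 * √(ε * Real.log T) ^ 2 * (1 - ((Real.exp (logEta ε) - 1) / 4) ^ 2) = Real.log T := by
  have hle : 1 / (2 * ε) ≤ 1 := (div_le_one (by linarith)).2 (by linarith)
  rw [exp_logEta, add_sub_cancel_left, mul_div_cancel_left₀ _ four_ne_zero,
    Real.sq_sqrt (sub_nonneg.2 hle), sub_sub_cancel,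
    Real.sq_sqrt (mul_nonneg (by linarith) (Real.log_nonneg hT))]
  field_simp

theorem Deviates.exists_le_expDev {ε : ℝ} (hε : 1 / 2 < ε) {τ : ℕ} (hτ : 2 ≤ τ) {s p : ℝ}
    (hs : s ^ 2 = 1) {a : Fin L} {h : History L K} (hd : Deviates ε τ s p a h) :
    ∃ k < ⌈Real.log (effWindow τ h) / logEta ε⌉₊, (effWindow τ h : ℝ) ≤
      expDev (s * sliceParam √(ε * Real.log (effWindow τ h)) (logEta ε) k) p a
        (min h.length τ) h := by
  obtain ⟨hobs, hdev⟩ := hd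
  have hN : (1 : ℝ) ≤ obsCount τ h a := mod_cast hobs
  have hNm : obsCount τ h a ≤ min h.length τ := obsCount_min_length τ h a ▸ obsCount_le _ _ _
  have hNT : (obsCount τ h a : ℝ) ≤ effWindow τ h := by
    exact_mod_cast hNm.trans (min_le_min_right τ h.length.le_succ)
  have hT : (1 : ℝ) < effWindow τ h := by
    rw [Nat.one_lt_cast, effWindow]
    omega
  obtain ⟨k, hk, hslice⟩ := exists_nat_abs_sub_le (Real.log_nonneg hN)
    (Real.log_le_log (by linarith) hNT) (Real.log_pos hT) (logEta_pos hε)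
  refine ⟨k, hk, ?_⟩
  have hexponent := sliceParam_exponent (Real.sqrt_nonneg _) (by linarith) hslice hdev
  rw [two_mul_sq_sqrt_mul_log hε hT.le] at hexponent
  rw [expDev, obsCount_min_length, clickCount_min_length, ← Real.log_le_iff_le_exp (by linarith),
    mul_pow, hs, one_mul]
  linarith

open scoped Classical in
theorem indicator_deviates_le {ε : ℝ} (hε : 1 / 2 < ε) {τ : ℕ} (hτ : 2 ≤ τ)
    {s : ℝ} (hs : s ^ 2 = 1) (p : ℝ) (a : Fin L) (h : History L K) :
    (if Deviates ε τ s p a h then 1 else 0)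
      ≤ ∑ k ∈ Finset.range ⌈Real.log (effWindow τ h) / logEta ε⌉₊,
        expDev (s * sliceParam √(ε * Real.log (effWindow τ h)) (logEta ε) k) p a
          (min h.length τ) h / effWindow τ h := by
  have hnonneg (k : ℕ) : 0 ≤ expDev (s * sliceParam √(ε * Real.log (effWindow τ h)) (logEta ε) k)
      p a (min h.length τ) h / effWindow τ h := div_nonneg (Real.exp_pos _).le (Nat.cast_nonneg _)
  split_ifs with hd
  · obtain ⟨k, hk, hle⟩ := hd.exists_le_expDev hε hτ hs
    have hT : (0 : ℝ) < effWindow τ h := by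
      rw [Nat.cast_pos, effWindow]
      omega
    exact ((one_le_div hT).2 hle).trans
      (Finset.single_le_sum (fun k _ ↦ hnonneg k) (Finset.mem_range.2 hk))
  · exact Finset.sum_nonneg fun k _ ↦ hnonneg k

open scoped Classical in
theorem IsEnvironment.integral_deviates_le {Ω : Type*} [MeasurableSpace Ω] {μ : Measure Ω}
    [IsProbabilityMeasure μ] {n : ℕ} {α : ℕ → Fin L → ℝ} {A : ℕ → Fin L → Ω → Bool}
    (hA : IsEnvironment μ n α A) (σ : History L K → Ranking L K) {ε : ℝ} (hε : 1 / 2 < ε) {τ : ℕ}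
    (hτ : 2 ≤ τ) {s : ℝ} (hs : s ^ 2 = 1) {p : ℝ} {a : Fin L} {t : ℕ} (ht : t ≤ n)
    (hp : ∀ r < t, t ≤ r + τ → α r a = p) :
    ∫ ω, (if Deviates ε τ s p a (randomHistory σ A t ω) then 1 else 0) ∂μ
      ≤ (⌈Real.log (min (t + 1) τ : ℕ) / logEta ε⌉₊ : ℝ) / (min (t + 1) τ : ℕ) := by
  let T := min (t + 1) τ
  let θ (k : ℕ) : ℝ := s * sliceParam √(ε * Real.log T) (logEta ε) k
  have hint (k : ℕ) :
      Integrable (fun ω ↦ expDev (θ k) p a (min t τ) (randomHistory σ A t ω) / T) μ :=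
    hA.integrable_history σ ht fun h ↦ expDev (θ k) p a (min t τ) h / T
  calc ∫ ω, (if Deviates ε τ s p a (randomHistory σ A t ω) then 1 else 0) ∂μ
      ≤ ∫ ω, ∑ k ∈ Finset.range ⌈Real.log T / logEta ε⌉₊,
          expDev (θ k) p a (min t τ) (randomHistory σ A t ω) / T ∂μ := by
        refine integral_mono
          (hA.integrable_history σ ht fun h ↦ if Deviates ε τ s p a h then (1 : ℝ) else 0)
          (integrable_finsetSum _ fun k _ ↦ hint k) fun ω ↦ ?_
        simpa only [effWindow, length_history] using
          indicator_deviates_le hε hτ hs p a (randomHistory σ A t ω)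
    _ = ∑ k ∈ Finset.range ⌈Real.log T / logEta ε⌉₊,
          (∫ ω, expDev (θ k) p a (min t τ) (randomHistory σ A t ω) ∂μ) / T := by
        rw [integral_finsetSum _ fun k _ ↦ hint k]
        simp only [integral_div]
    _ ≤ ∑ k ∈ Finset.range ⌈Real.log T / logEta ε⌉₊, 1 / (T : ℝ) := by
        gcongr with k
        exact hA.integral_expDev_le_one σ (θ k) p a (min_le_left _ _) ht
          fun r hr hr' ↦ hp r hr (by omega)
    _ = ⌈Real.log T / logEta ε⌉₊ / T := by
        rw [Finset.sum_const, Finset.card_range, nsmul_eq_mul, mul_one_div]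

end Peeling

section Blocks

/-- An upper bound on the gap of a displayed suboptimal item that was observed `j` times in the
window, in a round where the confidence bounds hold. Here `Δ` is the smallest gap of the item and
`c = ε ln τ`; once `j` exceeds `4 * c / Δ ^ 2` the item is not displayed any more. -/
noncomputable def penalty (c Δ : ℝ) (j : ℕ) : ℝ :=
  if Δ ^ 2 * j ≤ 4 * c then 2 * √c / √(max j 1 : ℕ) else 0

theorem penalty_nonneg (c Δ : ℝ) (j : ℕ) : 0 ≤ penalty c Δ j := by
  unfold penalty
  split_ifs <;> positivity

theorem penalty_le (c Δ : ℝ) (j : ℕ) : penalty c Δ j ≤ 2 * √c / √(max j 1 : ℕ) := by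
  unfold penalty
  split_ifs
  · rfl
  · positivity

theorem penalty_antitone (c Δ : ℝ) : Antitone (penalty c Δ) := by
  intro i j hij
  by_cases hj : Δ ^ 2 * j ≤ 4 * c
  · have hi : Δ ^ 2 * i ≤ 4 * c := le_trans (by gcongr) hj
    rw [penalty, penalty, if_pos hi, if_pos hj]
    gcongr
  · rw [penalty, if_neg hj]
    exact penalty_nonneg _ _ _

theorem sum_inv_sqrt_le {m : ℕ} (hm : 1 ≤ m) :
    ∑ j ∈ Finset.range (m + 1), 1 / √(max j 1 : ℕ) ≤ 2 * √m := by
  induction m, hm using Nat.le_induction with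
  | base => norm_num [Finset.sum_range_succ]
  | succ m _ ih =>
    rw [Finset.sum_range_succ, max_eq_left (by omega)]
    have hx : √(m : ℝ) ^ 2 = m := Real.sq_sqrt (by positivity)
    have hy : √((m + 1 : ℕ) : ℝ) ^ 2 = m + 1 := by
      rw [Real.sq_sqrt (by positivity), Nat.cast_succ]
    have hstep : 1 / √((m + 1 : ℕ) : ℝ) ≤ 2 * √((m + 1 : ℕ) : ℝ) - 2 * √m := by
      rw [div_le_iff₀ (by positivity)]
      nlinarith [sq_nonneg (√(m : ℝ) - √((m + 1 : ℕ) : ℝ))]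
    linarith

theorem sum_penalty_le {c Δ : ℝ} (hc : 1 / 4 ≤ c) (hΔ : 0 < Δ) (hΔ1 : Δ ≤ 1) (M : ℕ) :
    ∑ j ∈ Finset.range M, penalty c Δ j ≤ 8 * c / Δ := by
  have hr : 1 ≤ 4 * c / Δ ^ 2 := by
    rw [one_le_div (by positivity)]
    nlinarith
  set m := ⌊4 * c / Δ ^ 2⌋₊
  have hm : 1 ≤ m := (Nat.one_le_floor_iff _).2 hr
  have hvanish (j : ℕ) (hj : j ≥ m + 1) : penalty c Δ j = 0 := by
    have hlt : 4 * c / Δ ^ 2 < j := (Nat.floor_lt (by linarith)).1 hj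
    rw [div_lt_iff₀' (by positivity)] at hlt
    exact if_neg hlt.not_ge
  have hsqrt : √(m : ℝ) ≤ 2 * √c / Δ := by
    rw [Real.sqrt_le_left (by positivity), div_pow, mul_pow, Real.sq_sqrt (by linarith)]
    exact (Nat.floor_le (by linarith)).trans_eq (by norm_num)
  calc ∑ j ∈ Finset.range M, penalty c Δ j
      ≤ ∑ j ∈ Finset.range (max M (m + 1)), penalty c Δ j :=
        Finset.sum_le_sum_of_subset_of_nonneg (Finset.range_subset_range.2 (le_max_left _ _))
          fun j _ _ ↦ penalty_nonneg c Δ j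
    _ = ∑ j ∈ Finset.range (m + 1), penalty c Δ j :=
        Finset.eventually_constant_sum hvanish (le_max_right _ _)
    _ ≤ 2 * √c * ∑ j ∈ Finset.range (m + 1), 1 / √(max j 1 : ℕ) := by
        rw [Finset.mul_sum]
        exact Finset.sum_le_sum fun j _ ↦ (penalty_le c Δ j).trans_eq (by ring)
    _ ≤ 2 * √c * (2 * (2 * √c / Δ)) := by
        gcongr
        exact (sum_inv_sqrt_le hm).trans (by gcongr)
    _ = 8 * c / Δ := by
        linear_combination 8 / Δ * Real.sq_sqrt (by linarith : 0 ≤ c)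

theorem sum_ite_le_sum_range_count {φ : ℕ → ℝ} (hφ : Antitone φ) (p : ℕ → Prop)
    [DecidablePred p] {N : ℕ → ℕ} {u : ℕ} (hN : ∀ i < u, Nat.count p i ≤ N i) :
    ∑ i ∈ Finset.range u, (if p i then φ (N i) else 0)
      ≤ ∑ j ∈ Finset.range (Nat.count p u), φ j := by
  induction u with
  | zero => simp
  | succ u ih =>
    have hle := ih fun i hi ↦ hN i (hi.trans u.lt_succ_self)
    rw [Finset.sum_range_succ, Nat.count_succ]
    split_ifs
    · rw [Finset.sum_range_succ]
      exact add_le_add hle (hφ (hN u u.lt_succ_self))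
    · simpa only [add_zero] using hle

theorem sum_range_mul_le {f : ℕ → ℝ} {τ : ℕ} {C : ℝ}
    (h : ∀ b, ∑ i ∈ Finset.range τ, f (b * τ + i) ≤ C) (q : ℕ) :
    ∑ t ∈ Finset.range (q * τ), f t ≤ q * C := by
  induction q with
  | zero => simp
  | succ q ih =>
    rw [Nat.succ_mul, Finset.sum_range_add]
    push_cast
    linarith [h q]

open scoped Classical in
/-- The penalty of item `a` in the round that follows the history `h`, charged only if the
attraction indicators `y` of that round let the agent observe `a`. -/
noncomputable def observedPenalty (c Δ : ℝ) (τ : ℕ) (σ : History L K → Ranking L K) (a : Fin L)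
    (h : History L K) (y : Fin L → Bool) : ℝ :=
  if Observed (feedback (σ h) y) a then penalty c Δ (obsCount τ h a) else 0

theorem observedPenalty_nonneg (c Δ : ℝ) (τ : ℕ) (σ : History L K → Ranking L K) (a : Fin L)
    (h : History L K) (y : Fin L → Bool) : 0 ≤ observedPenalty c Δ τ σ a h y := by
  unfold observedPenalty
  split_ifs
  · exact penalty_nonneg _ _ _
  · rfl

theorem sum_bernoulliWeight_mul_observedPenalty (v : Fin L → ℝ) (c Δ : ℝ) (τ : ℕ)
    (σ : History L K → Ranking L K) (a : Fin L) (h : History L K) :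
    ∑ y, bernoulliWeight v y * observedPenalty c Δ τ σ a h y
      = obsProb v (σ h) a * penalty c Δ (obsCount τ h a) := by
  simp only [obsProb, observedPenalty, Finset.sum_mul, mul_assoc, ite_mul, one_mul, zero_mul]

open scoped Classical in
theorem obsCount_history_add (σ : History L K → Ranking L K) (x : ℕ → Fin L → Bool) (a : Fin L)
    (s i : ℕ) :
    obsCount i (history σ x (s + i)) a
      = Nat.count (fun j ↦ Observed (feedback (σ (history σ x (s + j))) (x (s + j))) a) i := by
  induction i with
  | zero => simp [obsCount]
  | succ i ih => rw [← Nat.add_assoc, history, obsCount_cons, Nat.count_succ, ih, feedback]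

-- Within a block of `τ` rounds the window contains every earlier round of the block, so that the
-- observations in the block are charged decreasing penalties `penalty c Δ 0, penalty c Δ 1, …`.
theorem sum_observedPenalty_block_le (σ : History L K → Ranking L K) (x : ℕ → Fin L → Bool)
    (a : Fin L) {c Δ : ℝ} (hc : 1 / 4 ≤ c) (hΔ : 0 < Δ) (hΔ1 : Δ ≤ 1) (τ s : ℕ) :
    ∑ i ∈ Finset.range τ, observedPenalty c Δ τ σ a (history σ x (s + i)) (x (s + i))
      ≤ 8 * c / Δ := by
  classical
  exact (sum_ite_le_sum_range_count (penalty_antitone c Δ)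
    (fun j ↦ Observed (feedback (σ (history σ x (s + j))) (x (s + j))) a)
    (N := fun j ↦ obsCount τ (history σ x (s + j)) a) fun i hi ↦
      obsCount_history_add σ x a s i ▸ obsCount_mono hi.le _ _).trans
    (sum_penalty_le hc hΔ hΔ1 _)

theorem sum_observedPenalty_le (σ : History L K → Ranking L K) (x : ℕ → Fin L → Bool)
    (a : Fin L) {c Δ : ℝ} (hc : 1 / 4 ≤ c) (hΔ : 0 < Δ) (hΔ1 : Δ ≤ 1) {τ : ℕ} (hτ : 0 < τ)
    (n : ℕ) :
    ∑ t ∈ Finset.range n, observedPenalty c Δ τ σ a (history σ x t) (x t)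
      ≤ ⌈(n : ℝ) / τ⌉₊ * (8 * c / Δ) := by
  have hn : n ≤ ⌈(n : ℝ) / τ⌉₊ * τ := by
    have hle := Nat.le_ceil ((n : ℝ) / τ)
    rw [div_le_iff₀ (by positivity)] at hle
    exact_mod_cast hle
  exact (Finset.sum_le_sum_of_subset_of_nonneg (Finset.range_subset_range.2 hn)
    fun t _ _ ↦ observedPenalty_nonneg _ _ _ _ _ _ _).trans
    (sum_range_mul_le (fun b ↦ sum_observedPenalty_block_le σ x a hc hΔ hΔ1 τ (b * τ)) _)

end Blocks

section Logarithms

theorem ceil_log_div_le {l : ℝ} (hl : 0 < l) (hl2 : l ≤ 2) {n : ℕ} (hn : 1 ≤ n) :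
    (⌈Real.log (n + 1 : ℕ) / l⌉₊ : ℝ) / (n + 1 : ℕ)
      ≤ (Real.log (n + 1 : ℕ) ^ 2 + 2 * Real.log (n + 1 : ℕ)) / l
        - (Real.log n ^ 2 + 2 * Real.log n) / l := by
  have hn' : (1 : ℝ) ≤ n := mod_cast hn
  set x := Real.log n
  set y := Real.log (n + 1 : ℕ)
  have hx : 0 ≤ x := Real.log_nonneg hn'
  have hxy : 1 / ((n + 1 : ℕ) : ℝ) ≤ y - x := by
    have h := Real.one_sub_inv_le_log_of_pos (x := (n + 1 : ℕ) / (n : ℝ)) (by positivity)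
    rw [Real.log_div (by positivity) (by positivity)] at h
    refine le_trans (le_of_eq ?_) h
    push_cast
    field_simp
    ring
  have hy : x ≤ y := sub_nonneg.1 (le_trans (by positivity) hxy)
  have hyl : 0 ≤ y / l := div_nonneg (hx.trans hy) hl.le
  calc (⌈y / l⌉₊ : ℝ) / (n + 1 : ℕ) = ⌈y / l⌉₊ * (1 / (n + 1 : ℕ)) := (mul_one_div _ _).symm
    _ ≤ (y / l + 1) * (y - x) :=
        mul_le_mul (Nat.ceil_lt_add_one hyl).le hxy (by positivity) (by linarith)
    _ = (y + l) * (y - x) / l := by field_simp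
    _ ≤ (y + x + 2) * (y - x) / l := by
        gcongr ?_ * _ / _
        linarith
    _ = (y ^ 2 + 2 * y) / l - (x ^ 2 + 2 * x) / l := by ring

theorem sum_ceil_log_div_le {l : ℝ} (hl : 0 < l) (hl2 : l ≤ 2) {n : ℕ} (hn : 1 ≤ n) :
    ∑ t ∈ Finset.range n, (⌈Real.log (t + 1 : ℕ) / l⌉₊ : ℝ) / (t + 1 : ℕ)
      ≤ (Real.log n ^ 2 + 2 * Real.log n) / l := by
  induction n, hn using Nat.le_induction with
  | base => simp
  | succ n hn ih =>
    rw [Finset.sum_range_succ]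
    linarith [ceil_log_div_le hl hl2 hn]

theorem log_sq_add_le {x y : ℝ} (hx : 1 ≤ x) (hxy : x ≤ y) :
    Real.log x ^ 2 + 2 * Real.log x ≤ Real.log y ^ 2 + 2 * Real.log y * (x / y) := by
  have hlogx : 0 ≤ Real.log x := Real.log_nonneg hx
  have hlogxy : Real.log x ≤ Real.log y := Real.log_le_log (by linarith) hxy
  have hratio : 1 - (Real.log y - Real.log x) ≤ x / y := by
    have h := Real.log_le_sub_one_of_pos (x := x / y) (div_pos (by linarith) (by linarith))
    rw [Real.log_div (by linarith) (by linarith)] at h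
    linarith
  have hratio0 : 0 ≤ x / y := div_nonneg (by linarith) (by linarith)
  rcases le_total (Real.log y - Real.log x) 2 with hle | hge
  · nlinarith [mul_le_mul_of_nonneg_left hratio (hlogx.trans hlogxy), hle]
  · nlinarith [mul_nonneg (hlogx.trans hlogxy) hratio0, hge]

theorem sum_ceil_log_div_le_of_le {l : ℝ} (hl : 0 < l) (hl2 : l ≤ 2) {n τ : ℕ} (hn : 1 ≤ n)
    (hnτ : n ≤ τ) :
    ∑ t ∈ Finset.range n, (⌈Real.log (t + 1 : ℕ) / l⌉₊ : ℝ) / (t + 1 : ℕ)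
      ≤ Real.log τ ^ 2 / l + 2 * ⌈Real.log τ / l⌉₊ * (n / τ) := by
  calc ∑ t ∈ Finset.range n, (⌈Real.log (t + 1 : ℕ) / l⌉₊ : ℝ) / (t + 1 : ℕ)
      ≤ (Real.log n ^ 2 + 2 * Real.log n) / l := sum_ceil_log_div_le hl hl2 hn
    _ ≤ (Real.log τ ^ 2 + 2 * Real.log τ * (n / τ)) / l := by
        gcongr ?_ / l
        exact log_sq_add_le (mod_cast hn) (mod_cast hnτ)
    _ = Real.log τ ^ 2 / l + 2 * (Real.log τ / l) * (n / τ) := by ring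
    _ ≤ Real.log τ ^ 2 / l + 2 * ⌈Real.log τ / l⌉₊ * (n / τ) := by
        gcongr
        exact Nat.le_ceil _

theorem sum_ceil_log_min_div_le {l : ℝ} (hl : 0 < l) (hl2 : l ≤ 2) {n τ : ℕ} (hn : 1 ≤ n)
    (hτ : 1 ≤ τ) :
    ∑ t ∈ Finset.range n, (⌈Real.log (min (t + 1) τ : ℕ) / l⌉₊ : ℝ) / (min (t + 1) τ : ℕ)
      ≤ Real.log τ ^ 2 / l + 2 * ⌈Real.log τ / l⌉₊ * (n / τ) := by
  have hmin {m : ℕ} (hm : m ≤ τ) :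
      ∑ t ∈ Finset.range m, (⌈Real.log (min (t + 1) τ : ℕ) / l⌉₊ : ℝ) / (min (t + 1) τ : ℕ)
        = ∑ t ∈ Finset.range m, (⌈Real.log (t + 1 : ℕ) / l⌉₊ : ℝ) / (t + 1 : ℕ) :=
    Finset.sum_congr rfl fun t ht ↦ by
      rw [min_eq_left ((Finset.mem_range.1 ht).trans_le hm)]
  rcases le_total n τ with h | h
  · rw [hmin h]
    exact sum_ceil_log_div_le_of_le hl hl2 hn h
  obtain ⟨d, rfl⟩ := Nat.exists_eq_add_of_le h
  have htail (t : ℕ) : min (τ + t + 1) τ = τ := min_eq_right (by omega)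
  simp only [Finset.sum_range_add, hmin le_rfl, htail, Finset.sum_const, Finset.card_range,
    nsmul_eq_mul]
  have hhead := sum_ceil_log_div_le_of_le hl hl2 hτ le_rfl
  have hd : 0 ≤ (d : ℝ) * (⌈Real.log τ / l⌉₊ / τ) := by positivity
  rw [Nat.cast_add τ d]
  linear_combination hhead + hd

end Logarithms

section Changes

theorem exists_ne_succ_of_ne {β : Type*} {f : ℕ → β} {r t : ℕ} (hrt : r ≤ t) (hne : f r ≠ f t) :
    ∃ q, r ≤ q ∧ q < t ∧ f (q + 1) ≠ f q := by
  induction t, hrt using Nat.le_induction with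
  | base => exact absurd rfl hne
  | succ t hrt ih =>
    by_cases ht : f (t + 1) = f t
    · obtain ⟨q, hrq, hqt, hq⟩ := ih (ht ▸ hne)
      exact ⟨q, hrq, hqt.trans t.lt_succ_self, hq⟩
    · exact ⟨t, hrt, t.lt_succ_self, ht⟩

/-- The attraction probabilities in the window of the `τ` rounds before round `t` are those of
round `t`. -/
def IsStationary (α : ℕ → Fin L → ℝ) (τ t : ℕ) : Prop :=
  ∀ r < t, t ≤ r + τ → α r = α t

open scoped Classical in
theorem card_not_isStationary_le (α : ℕ → Fin L → ℝ) (n τ : ℕ) :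
    ((Finset.range n).filter fun t ↦ ¬ IsStationary α τ t).card ≤ numChanges α n * τ := by
  calc ((Finset.range n).filter fun t ↦ ¬ IsStationary α τ t).card
      ≤ (((Finset.range n).filter fun t ↦ t + 1 < n ∧ α (t + 1) ≠ α t).biUnion
          fun q ↦ Finset.Ioc q (q + τ)).card := by
        refine Finset.card_le_card fun t ht ↦ ?_
        simp only [IsStationary, Finset.mem_filter, Finset.mem_range, not_forall] at ht
        obtain ⟨htn, r, hr, hrτ, hne⟩ := ht
        obtain ⟨q, hrq, hqt, hq⟩ := exists_ne_succ_of_ne hr.le hne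
        simp only [Finset.mem_biUnion, Finset.mem_filter, Finset.mem_range, Finset.mem_Ioc]
        exact ⟨q, ⟨by omega, by omega, hq⟩, hqt, by omega⟩
    _ ≤ numChanges α n * τ := Finset.card_biUnion_le_card_mul _ _ _ fun q _ ↦ by simp

theorem numChanges_lt {α : ℕ → Fin L → ℝ} {n : ℕ} (hn : 1 ≤ n) : numChanges α n < n := by
  classical
  have hsub : ((Finset.range n).filter fun t ↦ t + 1 < n ∧ α (t + 1) ≠ α t)
      ⊆ Finset.range (n - 1) := fun t ht ↦ by
    simp only [Finset.mem_filter, Finset.mem_range] at ht ⊢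
    omega
  have hcard := Finset.card_le_card hsub
  rw [Finset.card_range] at hcard
  rw [numChanges]
  omega

end Changes

section Gaps

variable {α : ℕ → Fin L → ℝ} {D : ℕ → Finset (Fin L)} {n : ℕ}

theorem gap_le (hα : ∀ t < n, ∀ a, α t a ∈ Set.Icc (0 : ℝ) 1) {t : ℕ} (ht : t < n) {a b : Fin L}
    (ha : a ∉ D t) (hb : b ∈ D t) : gap α D n a ≤ α t b - α t a := by
  refine csInf_le ⟨-1, ?_⟩ ⟨t, ht, ha, b, hb, rfl⟩
  rintro x ⟨s, hs, -, c, -, rfl⟩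
  linarith [(hα s hs c).1, (hα s hs a).2]

theorem gap_le_one (hα : ∀ t < n, ∀ a, α t a ∈ Set.Icc (0 : ℝ) 1) (a : Fin L) :
    gap α D n a ≤ 1 := by
  by_cases h : ∃ t < n, a ∉ D t ∧ (D t).Nonempty
  · obtain ⟨t, ht, ha, b, hb⟩ := h
    linarith [gap_le hα ht ha hb, (hα t ht b).2, (hα t ht a).1]
  · refine (congrArg sInf (Set.eq_empty_of_forall_notMem ?_)).trans_le
      (Real.sInf_empty.trans_le zero_le_one)
    rintro x ⟨t, ht, ha, b, hb, -⟩
    exact h ⟨t, ht, ha, b, hb⟩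

theorem le_gap {δ : ℝ} (h : ∀ t < n, ∀ a ∉ D t, ∀ b ∈ D t, δ ≤ α t b - α t a) {a : Fin L}
    (ha : ∃ t < n, a ∉ D t ∧ (D t).Nonempty) : δ ≤ gap α D n a := by
  obtain ⟨t, ht, hat, b, hb⟩ := ha
  refine le_csInf ⟨_, t, ht, hat, b, hb, rfl⟩ ?_
  rintro x ⟨s, hs, has, c, hc, rfl⟩
  exact h s hs a has c hc

open scoped Classical in
/-- The items that are suboptimal in at least one of the `n` rounds. -/
noncomputable def suboptimal (D : ℕ → Finset (Fin L)) (n : ℕ) : Finset (Fin L) :=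
  {a | ∃ t < n, a ∉ D t}

theorem mem_suboptimal {a : Fin L} : a ∈ suboptimal D n ↔ ∃ t < n, a ∉ D t := by
  simp [suboptimal]

theorem invGap_eq {a : Fin L} (ha : a ∈ suboptimal D n) : invGap α D n a = 1 / gap α D n a :=
  if_pos (mem_suboptimal.1 ha)

theorem invGap_eq_zero {a : Fin L} (ha : a ∉ suboptimal D n) : invGap α D n a = 0 :=
  if_neg (mt mem_suboptimal.2 ha)

end Gaps

section ConfidenceBounds

variable {ε : ℝ} {τ : ℕ} {h : History L K}

theorem quarter_le_mul_log (hε : 1 / 2 < ε) (hτ : 2 ≤ τ) : 1 / 4 ≤ ε * Real.log τ := by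
  have hlog : Real.log 2 ≤ Real.log τ := Real.log_le_log two_pos (mod_cast hτ)
  nlinarith [Real.log_two_gt_d9]

theorem ucb_of_pos {a : Fin L} (ha : 0 < obsCount τ h a) :
    ucb ε τ h a = clickCount τ h a / obsCount τ h a
      + √(ε * Real.log (effWindow τ h)) / √(obsCount τ h a) := by
  rw [ucb, divOne, divOne, if_neg ha.ne', if_neg ha.ne', Real.sqrt_div' _ (by positivity),
    effWindow]

theorem ucb_le_of_not_deviates {p : ℝ} {a : Fin L} (ha : 0 < obsCount τ h a)
    (hdev : ¬ Deviates ε τ 1 p a h) :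
    ucb ε τ h a ≤ p + 2 * √(ε * Real.log (effWindow τ h)) / √(obsCount τ h a) := by
  have hlt := lt_of_not_ge fun hle ↦ hdev ⟨ha, hle⟩
  have hN : (0 : ℝ) < obsCount τ h a := mod_cast ha
  have hmean : (clickCount τ h a : ℝ) / obsCount τ h a
      ≤ p + √(ε * Real.log (effWindow τ h)) / √(obsCount τ h a) := by
    rw [div_le_iff₀ hN, add_mul, div_mul_eq_mul_div, mul_div_assoc, Real.div_sqrt]
    linarith
  rw [ucb_of_pos ha]
  linear_combination hmean

theorem le_ucb_of_not_deviates {p : ℝ} (hp : p ≤ 1) {a : Fin L}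
    (hdev : ¬ Deviates ε τ (-1) p a h) : p ≤ ucb ε τ h a := by
  rcases Nat.eq_zero_or_pos (obsCount τ h a) with h0 | ha
  · rw [ucb, divOne, divOne, if_pos h0, if_pos h0, Real.sqrt_one]
    linarith
  have hlt := lt_of_not_ge fun hle ↦ hdev ⟨ha, hle⟩
  have hN : (0 : ℝ) < obsCount τ h a := mod_cast ha
  rw [ucb_of_pos ha, ← sub_le_iff_le_add, le_div_iff₀ hN, sub_mul, div_mul_eq_mul_div,
    mul_div_assoc, Real.div_sqrt]
  linarith

theorem sub_le_penalty (hε : 1 / 2 < ε) (hτ : 2 ≤ τ) {p q Δ : ℝ} (hp : 0 ≤ p) (hq : q ≤ 1)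
    (hΔ : 0 < Δ) (hgap : Δ ≤ q - p) {a b : Fin L} (hucb : ucb ε τ h b ≤ ucb ε τ h a)
    (ha : ¬ Deviates ε τ 1 p a h) (hb : ¬ Deviates ε τ (-1) q b h) :
    q - p ≤ penalty (ε * Real.log τ) Δ (obsCount τ h a) := by
  have hc := quarter_le_mul_log hε hτ
  rcases Nat.eq_zero_or_pos (obsCount τ h a) with h0 | hpos
  · have hsqrt : 1 / 2 ≤ √(ε * Real.log τ) := Real.le_sqrt_of_sq_le (by linarith)
    rw [h0, penalty, if_pos (by rw [Nat.cast_zero, mul_zero]; linarith), max_eq_right zero_le_one,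
      Nat.cast_one, Real.sqrt_one, div_one]
    linarith
  have hN : (0 : ℝ) < obsCount τ h a := mod_cast hpos
  have hle : q - p ≤ 2 * √(ε * Real.log τ) / √(obsCount τ h a) := by
    have hT : (0 : ℝ) < effWindow τ h := by
      rw [Nat.cast_pos, effWindow]
      omega
    have hTτ : (effWindow τ h : ℝ) ≤ τ := mod_cast min_le_right _ _
    calc q - p ≤ 2 * √(ε * Real.log (effWindow τ h)) / √(obsCount τ h a) := by
          linarith [le_ucb_of_not_deviates hq hb, ucb_le_of_not_deviates hpos ha]
      _ ≤ 2 * √(ε * Real.log τ) / √(obsCount τ h a) := by gcongr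
  have hunresolved : Δ ^ 2 * obsCount τ h a ≤ 4 * (ε * Real.log τ) := by
    have hmul := (le_div_iff₀ (Real.sqrt_pos.2 hN)).1 (hgap.trans hle)
    have hsq := pow_le_pow_left₀ (by positivity) hmul 2
    rw [mul_pow, mul_pow, Real.sq_sqrt hN.le, Real.sq_sqrt (by linarith)] at hsq
    linarith
  rwa [penalty, if_pos hunresolved, max_eq_left hpos]

open scoped Classical in
theorem IsCascadeSWUCB.loss_le {σ : History L K → Ranking L K} (hσ : IsCascadeSWUCB ε τ σ)
    (hε : 1 / 2 < ε) (hτ : 2 ≤ τ) {v : Fin L → ℝ} (hv : ∀ a, v a ∈ Set.Icc (0 : ℝ) 1)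
    {D : Finset (Fin L)} (hD : D.card = K) (hopt : ∀ b ∈ D, ∀ a ∉ D, v a ≤ v b)
    {Δ : Fin L → ℝ} (hΔ : ∀ a ∉ D, 0 < Δ a) (hgap : ∀ a ∉ D, ∀ b ∈ D, Δ a ≤ v b - v a)
    (h : History L K) :
    loss v (σ h) ≤ ∑ a, (if Deviates ε τ (if a ∈ D then -1 else 1) (v a) a h then 1 else 0)
      + ∑ a with a ∉ D, obsProb v (σ h) a * penalty (ε * Real.log τ) (Δ a) (obsCount τ h a) := by
  have hdev_nonneg (a : Fin L) :
      (0 : ℝ) ≤ if Deviates ε τ (if a ∈ D then -1 else 1) (v a) a h then 1 else 0 := by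
    split_ifs <;> norm_num
  by_cases hdev : ∃ a, Deviates ε τ (if a ∈ D then -1 else 1) (v a) a h
  · obtain ⟨a, ha⟩ := hdev
    have hone := Finset.single_le_sum (fun a _ ↦ hdev_nonneg a) (Finset.mem_univ a)
    rw [if_pos ha] at hone
    refine (loss_le_one hv _).trans (hone.trans (le_add_of_nonneg_right ?_))
    exact Finset.sum_nonneg fun a _ ↦ mul_nonneg (obsProb_nonneg hv _ _) (penalty_nonneg _ _ _)
  · push Not at hdev
    refine (loss_le_sum_obsProb hv hD hopt (σ h) fun a haσ haD b hbD hbσ ↦ ?_).trans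
      (le_add_of_nonneg_left (Finset.sum_nonneg fun a _ ↦ hdev_nonneg a))
    have ha := hdev a
    have hb := hdev b
    rw [if_neg haD] at ha
    rw [if_pos hbD] at hb
    exact sub_le_penalty hε hτ (hv a).1 (hv b).2 (hΔ a haD) (hgap a haD b hbD)
      (hσ h a haσ b hbσ) ha hb

end ConfidenceBounds

section Regret

variable {Ω : Type*} [MeasurableSpace Ω] {μ : Measure Ω} [IsProbabilityMeasure μ]
  {n : ℕ} {α : ℕ → Fin L → ℝ} {A : ℕ → Fin L → Ω → Bool} {D : ℕ → Finset (Fin L)}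
  {ε : ℝ} {τ : ℕ} {σ : History L K → Ranking L K}

namespace IsEnvironment

theorem integrable_observedPenalty (hA : IsEnvironment μ n α A) (c Δ : ℝ) (τ : ℕ)
    (σ : History L K → Ranking L K) (a : Fin L) {t : ℕ} (ht : t < n) :
    Integrable (fun ω ↦ observedPenalty c Δ τ σ a (randomHistory σ A t ω) (row A t ω)) μ :=
  hA.integrable_history_row σ ht (observedPenalty c Δ τ σ a)

theorem integral_observedPenalty (hA : IsEnvironment μ n α A) (c Δ : ℝ) (τ : ℕ)
    (σ : History L K → Ranking L K) (a : Fin L) {t : ℕ} (ht : t < n) :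
    ∫ ω, observedPenalty c Δ τ σ a (randomHistory σ A t ω) (row A t ω) ∂μ
      = ∫ ω, obsProb (α t) (σ (randomHistory σ A t ω)) a
          * penalty c Δ (obsCount τ (randomHistory σ A t ω) a) ∂μ := by
  rw [hA.integral_history_row σ ht (observedPenalty c Δ τ σ a)]
  simp only [sum_bernoulliWeight_mul_observedPenalty]

theorem regret_eq (hA : IsEnvironment μ n α A) (σ : History L K → Ranking L K) :
    regret μ α A σ n
      = ∑ t ∈ Finset.range n, ∫ ω, loss (α t) (σ (randomHistory σ A t ω)) ∂μ := by
  refine Finset.sum_congr rfl fun t ht ↦ ?_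
  rw [hA.integral_history_row σ (Finset.mem_range.1 ht) fun h y ↦
    (⨆ S : Ranking L K, reward S (α t)) - reward (σ h) fun a ↦ if y a = true then 1 else 0]
  simp only [mul_sub, Finset.sum_sub_distrib, ← Finset.sum_mul, sum_bernoulliWeight, one_mul,
    sum_bernoulliWeight_mul_reward, loss]

theorem integral_loss_le_one (hA : IsEnvironment μ n α A) (σ : History L K → Ranking L K) {t : ℕ}
    (ht : t < n) : ∫ ω, loss (α t) (σ (randomHistory σ A t ω)) ∂μ ≤ 1 := by
  calc ∫ ω, loss (α t) (σ (randomHistory σ A t ω)) ∂μ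
      ≤ ∫ _, (1 : ℝ) ∂μ :=
        integral_mono (hA.integrable_history σ ht.le fun h ↦ loss (α t) (σ h))
          (integrable_const _) fun ω ↦ loss_le_one (hA.mem_Icc ht) _
    _ = 1 := by simp

open scoped Classical in
theorem integral_loss_le_of_isStationary (hA : IsEnvironment μ n α A) (hε : 1 / 2 < ε)
    (hτ : 2 ≤ τ) (hσ : IsCascadeSWUCB ε τ σ) (hD : IsOptimalSets K n α D)
    (hgap : ∀ a ∈ suboptimal D n, 0 < gap α D n a) {t : ℕ} (ht : t < n)
    (hstat : IsStationary α τ t) :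
    ∫ ω, loss (α t) (σ (randomHistory σ A t ω)) ∂μ
      ≤ L * (⌈Real.log (min (t + 1) τ : ℕ) / logEta ε⌉₊ / (min (t + 1) τ : ℕ))
        + ∑ a with a ∉ D t, ∫ ω, observedPenalty (ε * Real.log τ) (gap α D n a) τ σ a
            (randomHistory σ A t ω) (row A t ω) ∂μ := by
  let dev (a : Fin L) (h : History L K) : ℝ :=
    if Deviates ε τ (if a ∈ D t then -1 else 1) (α t a) a h then 1 else 0
  let pen (a : Fin L) (h : History L K) : ℝ :=
    obsProb (α t) (σ h) a * penalty (ε * Real.log τ) (gap α D n a) (obsCount τ h a)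
  have hint (F : History L K → ℝ) : Integrable (fun ω ↦ F (randomHistory σ A t ω)) μ :=
    hA.integrable_history σ ht.le F
  calc ∫ ω, loss (α t) (σ (randomHistory σ A t ω)) ∂μ
      ≤ ∫ ω, (∑ a, dev a (randomHistory σ A t ω)
          + ∑ a with a ∉ D t, pen a (randomHistory σ A t ω)) ∂μ :=
        integral_mono (hint fun h ↦ loss (α t) (σ h))
          (hint fun h ↦ ∑ a, dev a h + ∑ a with a ∉ D t, pen a h) fun ω ↦
          hσ.loss_le hε hτ (hA.mem_Icc ht) (hD t ht).1 (hD t ht).2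
            (fun a ha ↦ hgap a (mem_suboptimal.2 ⟨t, ht, ha⟩))
            (fun a ha b hb ↦ gap_le (fun s hs ↦ hA.mem_Icc hs) ht ha hb) _
    _ = ∑ a, ∫ ω, dev a (randomHistory σ A t ω) ∂μ
          + ∑ a with a ∉ D t, ∫ ω, pen a (randomHistory σ A t ω) ∂μ := by
        rw [integral_add (hint fun h ↦ ∑ a, dev a h) (hint fun h ↦ ∑ a with a ∉ D t, pen a h),
          integral_finsetSum _ fun a _ ↦ hint (dev a), integral_finsetSum _ fun a _ ↦ hint (pen a)]
    _ ≤ ∑ _ : Fin L, (⌈Real.log (min (t + 1) τ : ℕ) / logEta ε⌉₊ : ℝ) / (min (t + 1) τ : ℕ)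
          + ∑ a with a ∉ D t, ∫ ω, observedPenalty (ε * Real.log τ) (gap α D n a) τ σ a
            (randomHistory σ A t ω) (row A t ω) ∂μ := by
        simp only [pen, hA.integral_observedPenalty _ _ _ σ _ ht]
        gcongr
        exact hA.integral_deviates_le σ hε hτ (by split_ifs <;> norm_num) ht.le
          fun r hr hrτ ↦ congrFun (hstat r hr hrτ) a
    _ = _ := by rw [Finset.sum_const, Finset.card_univ, Fintype.card_fin, nsmul_eq_mul]

open scoped Classical in
theorem integral_loss_le (hA : IsEnvironment μ n α A) (hε : 1 / 2 < ε)
    (hτ : 2 ≤ τ) (hσ : IsCascadeSWUCB ε τ σ) (hD : IsOptimalSets K n α D)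
    (hgap : ∀ a ∈ suboptimal D n, 0 < gap α D n a) {t : ℕ} (ht : t < n) :
    ∫ ω, loss (α t) (σ (randomHistory σ A t ω)) ∂μ
      ≤ (if ¬ IsStationary α τ t then 1 else 0)
        + L * (⌈Real.log (min (t + 1) τ : ℕ) / logEta ε⌉₊ / (min (t + 1) τ : ℕ))
        + ∑ a ∈ suboptimal D n, ∫ ω, observedPenalty (ε * Real.log τ) (gap α D n a) τ σ a
            (randomHistory σ A t ω) (row A t ω) ∂μ := by
  have hpen (a : Fin L) : 0 ≤ ∫ ω, observedPenalty (ε * Real.log τ) (gap α D n a) τ σ a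
      (randomHistory σ A t ω) (row A t ω) ∂μ :=
    integral_nonneg fun ω ↦ observedPenalty_nonneg _ _ _ _ _ _ _
  by_cases hstat : IsStationary α τ t
  · rw [if_neg (not_not.2 hstat), zero_add]
    refine (hA.integral_loss_le_of_isStationary hε hτ hσ hD hgap ht hstat).trans ?_
    refine add_le_add_right
      (Finset.sum_le_sum_of_subset_of_nonneg (fun a ha ↦ ?_) fun a _ _ ↦ hpen a) _
    exact mem_suboptimal.2 ⟨t, ht, (Finset.mem_filter.1 ha).2⟩
  · rw [if_pos hstat, add_assoc]
    exact (hA.integral_loss_le_one σ ht).trans (le_add_of_nonneg_right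
      (add_nonneg (by positivity) (Finset.sum_nonneg fun a _ ↦ hpen a)))

theorem sum_integral_observedPenalty_le (hA : IsEnvironment μ n α A)
    (σ : History L K → Ranking L K) (a : Fin L) {c Δ : ℝ} (hc : 1 / 4 ≤ c) (hΔ : 0 < Δ)
    (hΔ1 : Δ ≤ 1) (hτ : 0 < τ) :
    ∑ t ∈ Finset.range n,
        ∫ ω, observedPenalty c Δ τ σ a (randomHistory σ A t ω) (row A t ω) ∂μ
      ≤ ⌈(n : ℝ) / τ⌉₊ * (8 * c / Δ) := by
  have hint (t : ℕ) (ht : t ∈ Finset.range n) :=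
    hA.integrable_observedPenalty c Δ τ σ a (Finset.mem_range.1 ht)
  calc ∑ t ∈ Finset.range n,
        ∫ ω, observedPenalty c Δ τ σ a (randomHistory σ A t ω) (row A t ω) ∂μ
      = ∫ ω, ∑ t ∈ Finset.range n,
          observedPenalty c Δ τ σ a (randomHistory σ A t ω) (row A t ω) ∂μ :=
        (integral_finsetSum _ hint).symm
    _ ≤ ∫ _, ⌈(n : ℝ) / τ⌉₊ * (8 * c / Δ) ∂μ :=
        integral_mono (integrable_finsetSum _ hint) (integrable_const _) fun ω ↦
          sum_observedPenalty_le σ (fun s a ↦ A s a ω) a hc hΔ hΔ1 hτ n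
    _ = ⌈(n : ℝ) / τ⌉₊ * (8 * c / Δ) := by simp

theorem regret_le_sum_suboptimal (hA : IsEnvironment μ n α A) (hε : 1 / 2 < ε) (hn : 1 ≤ n)
    (hτ : 2 ≤ τ) (hσ : IsCascadeSWUCB ε τ σ) (hD : IsOptimalSets K n α D)
    (hgap : ∀ a ∈ suboptimal D n, 0 < gap α D n a) :
    regret μ α A σ n ≤ numChanges α n * τ
      + L * (Real.log τ ^ 2 / logEta ε + 2 * ⌈Real.log τ / logEta ε⌉₊ * (n / τ))
      + ∑ a ∈ suboptimal D n, ⌈(n : ℝ) / τ⌉₊ * (8 * (ε * Real.log τ) / gap α D n a) := by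
  classical
  have hchanges : (∑ t ∈ Finset.range n, if ¬ IsStationary α τ t then (1 : ℝ) else 0)
      ≤ numChanges α n * τ := by
    rw [Finset.sum_boole]
    exact_mod_cast card_not_isStationary_le α n τ
  rw [hA.regret_eq σ]
  refine (Finset.sum_le_sum fun t ht ↦
    hA.integral_loss_le hε hτ hσ hD hgap (Finset.mem_range.1 ht)).trans ?_
  rw [Finset.sum_add_distrib, Finset.sum_add_distrib, ← Finset.mul_sum, Finset.sum_comm]
  gcongr with a ha
  · exact sum_ceil_log_min_div_le (logEta_pos hε) (logEta_le_two hε) hn (by omega)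
  · exact hA.sum_integral_observedPenalty_le σ a (quarter_le_mul_log hε hτ) (hgap a ha)
      (gap_le_one (fun s hs ↦ hA.mem_Icc hs) a) (by omega)

end IsEnvironment

theorem swConst_mul (hε : 1 / 2 < ε) (hn : 0 < n) (hτ : 2 ≤ τ) (g : ℝ) :
    swConst ε n τ g * (n * Real.log τ / τ)
      = 2 * ⌈Real.log τ / logEta ε⌉₊ * (n / τ)
        + ⌈(n : ℝ) / τ⌉₊ * (8 * (ε * Real.log τ) * g) := by
  have hτ' : (1 : ℝ) < τ := mod_cast hτ
  have hlog : 0 < Real.log τ := Real.log_pos hτ'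
  have hl := logEta_pos hε
  rw [swConst, natCast_ceil_eq_intCast_ceil (by positivity),
    natCast_ceil_eq_intCast_ceil (by positivity)]
  field_simp

theorem IsEnvironment.regret_le (hA : IsEnvironment μ n α A) (hK : 1 ≤ K) (hε : 1 / 2 < ε)
    (hn : 1 ≤ n) (hτ : 2 ≤ τ) (hσ : IsCascadeSWUCB ε τ σ) (hD : IsOptimalSets K n α D)
    (hgap : ∀ a ∈ suboptimal D n, 0 < gap α D n a) :
    regret μ α A σ n ≤ L * numChanges α n * τ + L * Real.log τ ^ 2 / logEta ε
      + ∑ a, swConst ε n τ (invGap α D n a) * (n * Real.log τ / τ) := by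
  have hL : (1 : ℝ) ≤ L := mod_cast Fin.pos (σ [] ⟨0, hK⟩)
  have hsub : ∑ a ∈ suboptimal D n, ⌈(n : ℝ) / τ⌉₊ * (8 * (ε * Real.log τ) / gap α D n a)
      = ∑ a, ⌈(n : ℝ) / τ⌉₊ * (8 * (ε * Real.log τ) * invGap α D n a) := by
    rw [← Finset.sum_subset (Finset.subset_univ (suboptimal D n)) fun a _ ha ↦ by
      rw [invGap_eq_zero ha, mul_zero, mul_zero]]
    exact Finset.sum_congr rfl fun a ha ↦ by rw [invGap_eq ha, mul_one_div]
  have hbound := hA.regret_le_sum_suboptimal hε hn hτ hσ hD hgap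
  have hchanges : (numChanges α n * τ : ℝ) ≤ L * (numChanges α n * τ) :=
    le_mul_of_one_le_left (by positivity) hL
  simp only [swConst_mul hε hn hτ, Finset.sum_add_distrib, Finset.sum_const, Finset.card_univ,
    Fintype.card_fin, nsmul_eq_mul]
  linear_combination hbound + hchanges + hsub

end Regret

section TunedWindow

variable {n τ Υ : ℕ}

theorem log_sq_le_of_mul_log_le {x s : ℝ} (hx : 1 ≤ x) (hs : 0 ≤ s) (h : x * Real.log x ≤ s ^ 2) :
    Real.log x ^ 2 ≤ 3 * s := by
  have hlog : 0 ≤ Real.log x := Real.log_nonneg hx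
  have hcube : Real.log x ^ 3 ≤ 6 * x := by
    have hexp := Real.pow_div_factorial_le_exp (Real.log x) hlog 3
    rw [Real.exp_log (by linarith), div_le_iff₀ (by positivity)] at hexp
    norm_num [Nat.factorial] at hexp
    linarith
  refine (abs_le_of_sq_le_sq' ?_ (by positivity)).2
  nlinarith [mul_le_mul_of_nonneg_right hcube hlog]

theorem one_le_sqrt_mul_log_div (hΥ : 1 ≤ Υ) (hΥn : Υ < n) : 1 ≤ √(n * Real.log n / Υ) := by
  have hn : (0 : ℝ) < n := mod_cast (Nat.zero_le Υ).trans_lt hΥn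
  have hsucc : (Υ : ℝ) + 1 ≤ n := mod_cast hΥn
  have hlog : n * (1 - (n : ℝ)⁻¹) ≤ n * Real.log n := by
    gcongr
    exact Real.one_sub_inv_le_log_of_pos hn
  rw [Real.one_le_sqrt, one_le_div (by positivity)]
  rw [mul_sub, mul_one, mul_inv_cancel₀ hn.ne'] at hlog
  linarith

theorem sqrt_mul_log_div_le (hΥ : 1 ≤ Υ) : √(n * Real.log n / Υ) ≤ n := by
  refine Real.sqrt_le_iff.2 ⟨by positivity, ?_⟩
  calc n * Real.log n / Υ
      ≤ n * Real.log n := div_le_self (by positivity) (mod_cast hΥ)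
    _ ≤ (n : ℝ) ^ 2 := by
      rw [sq]
      gcongr
      exact Real.log_le_self n.cast_nonneg

theorem mul_sq_sqrt_mul_log_div (hΥ : 1 ≤ Υ) :
    Υ * √(n * Real.log n / Υ) ^ 2 = n * Real.log n := by
  rw [Real.sq_sqrt (by positivity), mul_div_cancel₀ _ (by positivity)]

theorem sqrt_mul_mul_log (hΥ : 1 ≤ Υ) :
    √(n * Υ * Real.log n) = Υ * √(n * Real.log n / Υ) := by
  rw [Real.sqrt_eq_iff_mul_self_eq (by positivity) (by positivity)]
  linear_combination -(Υ : ℝ) * mul_sq_sqrt_mul_log_div (n := n) hΥ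

theorem mem_Icc_of_abs_sub_lt {x q : ℝ} (hq : 1 ≤ q) (hx : |x - 2 * q| < 1) :
    x ∈ Set.Icc q (3 * q) := by
  obtain ⟨hlo, hhi⟩ := abs_lt.1 hx
  exact ⟨by linarith, by linarith⟩

theorem two_le_of_tuned (hΥ : 1 ≤ Υ) (hΥn : Υ < n)
    (hτ : |(τ : ℝ) - 2 * √(n * Real.log n / Υ)| < 1) : 2 ≤ τ := by
  have hτ1 : (1 : ℝ) < τ := by
    linarith [(abs_lt.1 hτ).1, one_le_sqrt_mul_log_div hΥ hΥn]
  exact_mod_cast hτ1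

theorem le_three_mul_of_tuned (hΥ : 1 ≤ Υ) (hΥn : Υ < n)
    (hτ : |(τ : ℝ) - 2 * √(n * Real.log n / Υ)| < 1) : (τ : ℝ) ≤ 3 * n := by
  linarith [(mem_Icc_of_abs_sub_lt (one_le_sqrt_mul_log_div hΥ hΥn) hτ).2,
    sqrt_mul_log_div_le (n := n) hΥ]

theorem log_le_three_mul_log_of_tuned (hΥ : 1 ≤ Υ) (hΥn : Υ < n)
    (hτ : |(τ : ℝ) - 2 * √(n * Real.log n / Υ)| < 1) : Real.log τ ≤ 3 * Real.log n := by
  have hτ2 : 2 ≤ τ := two_le_of_tuned hΥ hΥn hτ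
  have hn : (2 : ℝ) ≤ n := mod_cast (by omega : 2 ≤ n)
  calc Real.log τ
      ≤ Real.log ((n : ℝ) ^ 3) := by
        gcongr
        calc (τ : ℝ) ≤ 3 * n := le_three_mul_of_tuned hΥ hΥn hτ
          _ ≤ n ^ 2 * n := by
            gcongr
            nlinarith
          _ = n ^ 3 := by ring
    _ = 3 * Real.log n := by rw [Real.log_pow, Nat.cast_ofNat]

theorem mul_le_of_tuned (hΥ : 1 ≤ Υ) (hΥn : Υ < n)
    (hτ : |(τ : ℝ) - 2 * √(n * Real.log n / Υ)| < 1) :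
    Υ * τ ≤ 3 * √(n * Υ * Real.log n) := by
  rw [sqrt_mul_mul_log hΥ, mul_left_comm]
  gcongr
  exact (mem_Icc_of_abs_sub_lt (one_le_sqrt_mul_log_div hΥ hΥn) hτ).2

theorem log_sq_le_of_tuned (hΥ : 1 ≤ Υ) (hΥn : Υ < n)
    (hτ : |(τ : ℝ) - 2 * √(n * Real.log n / Υ)| < 1) :
    Real.log τ ^ 2 ≤ 27 * √(n * Υ * Real.log n) := by
  have hn : (1 : ℝ) ≤ n := mod_cast hΥ.trans hΥn.le
  have hΥ1 : (1 : ℝ) ≤ Υ := mod_cast hΥ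
  have hmul : n * Real.log n ≤ √(n * Υ * Real.log n) ^ 2 := by
    rw [Real.sq_sqrt (by positivity), mul_right_comm]
    exact le_mul_of_one_le_right (by positivity) hΥ1
  calc Real.log τ ^ 2
      ≤ (3 * Real.log n) ^ 2 := by
        gcongr
        exact log_le_three_mul_log_of_tuned hΥ hΥn hτ
    _ ≤ 27 * √(n * Υ * Real.log n) := by
        linarith [log_sq_le_of_mul_log_le hn (Real.sqrt_nonneg _) hmul]

theorem mul_log_div_le_of_tuned (hΥ : 1 ≤ Υ) (hΥn : Υ < n)
    (hτ : |(τ : ℝ) - 2 * √(n * Real.log n / Υ)| < 1) :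
    n * Real.log τ / τ ≤ 3 * √(n * Υ * Real.log n) := by
  have hq : 1 ≤ √(n * Real.log n / Υ) := one_le_sqrt_mul_log_div hΥ hΥn
  have hqτ := (mem_Icc_of_abs_sub_lt hq hτ).1
  calc n * Real.log τ / τ
      ≤ n * (3 * Real.log n) / √(n * Real.log n / Υ) := by
        gcongr
        exact log_le_three_mul_log_of_tuned hΥ hΥn hτ
    _ = 3 * √(n * Υ * Real.log n) := by
        rw [sqrt_mul_mul_log hΥ, div_eq_iff (by positivity)]
        linear_combination -3 * mul_sq_sqrt_mul_log_div (n := n) hΥ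

end TunedWindow

section Rates

theorem tendsto_intCeil_div_atTop : Tendsto (fun x : ℝ ↦ (⌈x⌉ : ℝ) / x) atTop (𝓝 1) := by
  refine (tendsto_nat_ceil_div_atTop (R := ℝ)).congr' ?_
  filter_upwards [eventually_ge_atTop 0] with x hx
  rw [natCast_ceil_eq_intCast_ceil hx]

theorem tendsto_swConst {ε : ℝ} (hε : 1 / 2 < ε) {ι : Type*} {l : Filter ι} {n τ : ι → ℕ}
    {g : ι → ℝ} {g₀ : ℝ} (hτ : Tendsto τ l atTop)
    (hnτ : Tendsto (fun k ↦ (n k : ℝ) / τ k) l atTop) (hg : Tendsto g l (𝓝 g₀)) :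
    Tendsto (fun k ↦ swConst ε (n k) (τ k) (g k)) l (𝓝 (2 / logEta ε + 8 * ε * g₀)) := by
  have hl := logEta_pos hε
  have hlog : Tendsto (fun k ↦ Real.log (τ k) / logEta ε) l atTop :=
    (Real.tendsto_log_atTop.comp (tendsto_natCast_atTop_atTop.comp hτ)).atTop_div_const hl
  have hslices := (tendsto_intCeil_div_atTop.comp hlog).const_mul (2 / logEta ε)
  have hblocks := (hg.const_mul (8 * ε)).mul (tendsto_intCeil_div_atTop.comp hnτ)
  rw [mul_one] at hslices hblocks
  refine (hslices.add hblocks).congr fun k ↦ ?_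
  simp only [Function.comp_apply, swConst, div_div_eq_mul_div]
  field_simp

theorem two_div_log_mul_ceil_le {l : ℝ} (hl : 0 < l) {τ : ℕ} (hτ : 2 ≤ τ) :
    2 / Real.log τ * ⌈Real.log τ / l⌉ ≤ 2 / l + 2 / Real.log 2 := by
  have hτ' : (2 : ℝ) ≤ τ := mod_cast hτ
  have hlog : 0 < Real.log τ := Real.log_pos (by linarith)
  calc 2 / Real.log τ * ⌈Real.log τ / l⌉
      ≤ 2 / Real.log τ * (Real.log τ / l + 1) := by
        gcongr
        exact (Int.ceil_lt_add_one _).le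
    _ = 2 / l + 2 / Real.log τ := by field_simp
    _ ≤ 2 / l + 2 / Real.log 2 := by gcongr

theorem ceil_div_le_four {x : ℝ} (hx : 1 / 3 ≤ x) : ⌈x⌉ / x ≤ 4 := by
  rw [div_le_iff₀ (by linarith)]
  linarith [Int.ceil_lt_add_one x]

theorem swConst_le {ε : ℝ} (hε : 1 / 2 < ε) {n τ : ℕ} (hτ : 2 ≤ τ) (hτn : (τ : ℝ) ≤ 3 * n)
    {g G : ℝ} (hG : 0 ≤ G) (hgG : g ≤ G) :
    swConst ε n τ g ≤ 2 / logEta ε + 2 / Real.log 2 + 32 * ε * G := by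
  have hτ0 : (0 : ℝ) < τ := mod_cast (by omega : 0 < τ)
  have hblocks : (⌈(n : ℝ) / τ⌉ : ℝ) / ((n : ℝ) / τ) ≤ 4 :=
    ceil_div_le_four (by rw [le_div_iff₀ hτ0]; linarith)
  calc swConst ε n τ g
      ≤ 2 / logEta ε + 2 / Real.log 2 + 8 * ε * G * 4 := by
        unfold swConst
        gcongr
        exact two_div_log_mul_ceil_le (logEta_pos hε) hτ
    _ = 2 / logEta ε + 2 / Real.log 2 + 32 * ε * G := by ring

/-- The constant of the `√(n Υ ln n)` regret bound for windows of size about `2 √(n ln n / Υ)`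
and gaps of at least `δ`. Its three summands account for the three terms of the bound for general
windows. -/
noncomputable def tunedConst (L : ℕ) (ε δ : ℝ) : ℝ :=
  3 * L + 27 * L / logEta ε + 3 * L * (2 / logEta ε + 2 / Real.log 2 + 32 * ε * (1 / δ))

variable {n : ℕ} {α : ℕ → Fin L → ℝ} {D : ℕ → Finset (Fin L)} {δ : ℝ}

theorem IsOptimalSets.le_gap (hD : IsOptimalSets K n α D) (hK : 1 ≤ K)
    (hgap : ∀ t < n, ∀ a ∉ D t, ∀ b ∈ D t, δ ≤ α t b - α t a) {a : Fin L}
    (ha : a ∈ suboptimal D n) : δ ≤ gap α D n a := by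
  obtain ⟨t, ht, hat⟩ := mem_suboptimal.1 ha
  exact CascadeBandit.le_gap hgap ⟨t, ht, hat, Finset.card_pos.1 ((hD t ht).1 ▸ hK)⟩

theorem IsOptimalSets.invGap_le (hD : IsOptimalSets K n α D) (hK : 1 ≤ K) (hδ : 0 < δ)
    (hgap : ∀ t < n, ∀ a ∉ D t, ∀ b ∈ D t, δ ≤ α t b - α t a) (a : Fin L) :
    invGap α D n a ≤ 1 / δ := by
  by_cases ha : a ∈ suboptimal D n
  · rw [invGap_eq ha]
    exact one_div_le_one_div_of_le hδ (hD.le_gap hK hgap ha)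
  · rw [invGap_eq_zero ha]
    positivity

theorem IsEnvironment.regret_le_of_tuned {Ω : Type*} [MeasurableSpace Ω] {μ : Measure Ω}
    [IsProbabilityMeasure μ] {A : ℕ → Fin L → Ω → Bool} {ε : ℝ} {τ : ℕ}
    {σ : History L K → Ranking L K} (hA : IsEnvironment μ n α A) (hK : 1 ≤ K) (hε : 1 / 2 < ε)
    (hσ : IsCascadeSWUCB ε τ σ) (hD : IsOptimalSets K n α D) (hδ : 0 < δ)
    (hgap : ∀ t < n, ∀ a ∉ D t, ∀ b ∈ D t, δ ≤ α t b - α t a) (hΥ : 1 ≤ numChanges α n)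
    (hτ : |(τ : ℝ) - 2 * √(n * Real.log n / numChanges α n)| < 1) :
    regret μ α A σ n ≤ tunedConst L ε δ * √(n * numChanges α n * Real.log n) := by
  have hl := logEta_pos hε
  have hn : 1 ≤ n := by
    rw [Nat.one_le_iff_ne_zero]
    rintro rfl
    simp [numChanges] at hΥ
  have hΥn : numChanges α n < n := numChanges_lt hn
  have hτ2 : 2 ≤ τ := two_le_of_tuned hΥ hΥn hτ
  have hconst (a : Fin L) : swConst ε n τ (invGap α D n a)
      ≤ 2 / logEta ε + 2 / Real.log 2 + 32 * ε * (1 / δ) :=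
    swConst_le hε hτ2 (le_three_mul_of_tuned hΥ hΥn hτ) (by positivity)
      (hD.invGap_le hK hδ hgap a)
  calc regret μ α A σ n
      ≤ L * (numChanges α n * τ) + L * Real.log τ ^ 2 / logEta ε
          + ∑ a, swConst ε n τ (invGap α D n a) * (n * Real.log τ / τ) := by
        rw [← mul_assoc]
        exact hA.regret_le hK hε hn hτ2 hσ hD fun a ha ↦ hδ.trans_le (hD.le_gap hK hgap ha)
    _ ≤ L * (3 * √(n * numChanges α n * Real.log n))
          + L * (27 * √(n * numChanges α n * Real.log n)) / logEta ε
          + ∑ _ : Fin L, (2 / logEta ε + 2 / Real.log 2 + 32 * ε * (1 / δ))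
              * (3 * √(n * numChanges α n * Real.log n)) := by
        gcongr L * ?_ + L * ?_ / _ + ∑ a, ?_ * ?_
        · exact mul_le_of_tuned hΥ hΥn hτ
        · exact log_sq_le_of_tuned hΥ hΥn hτ
        · exact hconst a
        · exact mul_log_div_le_of_tuned hΥ hΥn hτ
    _ = tunedConst L ε δ * √(n * numChanges α n * Real.log n) := by
        rw [Finset.sum_const, Finset.card_univ, Fintype.card_fin, nsmul_eq_mul, tunedConst]
        ring

end Rates

end CascadeBandit

theorem theorem2_general (L K : ℕ) (hK : 1 ≤ K) (ε : ℝ) (hε : 1 / 2 < ε) :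
    (∀ (n τ : ℕ), 1 ≤ n → 2 ≤ τ →
      ∀ (Ω : Type u) [MeasurableSpace Ω] (μ : Measure Ω) [IsProbabilityMeasure μ]
        (α : ℕ → Fin L → ℝ) (A : ℕ → Fin L → Ω → Bool) (D : ℕ → Finset (Fin L))
        (σ : History L K → Ranking L K),
        IsEnvironment μ n α A → IsOptimalSets K n α D → IsCascadeSWUCB ε τ σ →
        (∀ a, (∃ t < n, a ∉ D t) → 0 < gap α D n a) →
        regret μ α A σ n ≤
          L * numChanges α n * τ + L * Real.log τ ^ 2 / logEta ε
            + ∑ a, swConst ε n τ (invGap α D n a) * (n * Real.log τ / τ)) ∧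
    (∀ (n τ : ℕ → ℕ) (g : ℕ → ℝ) (g₀ : ℝ),
      Tendsto τ atTop atTop → Tendsto (fun k ↦ (n k : ℝ) / τ k) atTop atTop →
      Tendsto g atTop (𝓝 g₀) →
      Tendsto (fun k ↦ swConst ε (n k) (τ k) (g k)) atTop (𝓝 (2 / logEta ε + 8 * ε * g₀))) ∧
    (∀ δ : ℝ, 0 < δ → ∃ C : ℝ, ∀ (n τ : ℕ)
      (Ω : Type u) [MeasurableSpace Ω] (μ : Measure Ω) [IsProbabilityMeasure μ]
        (α : ℕ → Fin L → ℝ) (A : ℕ → Fin L → Ω → Bool) (D : ℕ → Finset (Fin L))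
        (σ : History L K → Ranking L K),
        IsEnvironment μ n α A → IsOptimalSets K n α D → IsCascadeSWUCB ε τ σ →
        (∀ t < n, ∀ a ∉ D t, ∀ b ∈ D t, δ ≤ α t b - α t a) →
        1 ≤ numChanges α n →
        |(τ : ℝ) - 2 * √(n * Real.log n / numChanges α n)| < 1 →
        regret μ α A σ n ≤ C * √(n * numChanges α n * Real.log n)) := by
  refine ⟨?_, ?_, ?_⟩
  · intro n τ hn hτ Ω _ μ _ α A D σ hA hD hσ hgap
    exact hA.regret_le hK hε hn hτ hσ hD fun a ha ↦ hgap a (mem_suboptimal.1 ha)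
  · intro n τ g g₀ hτ hnτ hg
    exact tendsto_swConst hε hτ hnτ hg
  · intro δ hδ
    refine ⟨tunedConst L ε δ, fun n τ Ω _ μ _ α A D σ hA hD hσ hgap hΥ hτ ↦ ?_⟩
    exact hA.regret_le_of_tuned hK hε hσ hD hδ hgap hΥ hτ

theorem theorem2 (L K : ℕ) (hK : 1 ≤ K) (hKL : K ≤ L) (ε : ℝ) (hε : ε ∈ Set.Ioo (1 / 2 : ℝ) 1) :
    -- the regret bound, for every window size
    (∀ (n τ : ℕ), 1 ≤ n → 2 ≤ τ →
      ∀ (Ω : Type u) [MeasurableSpace Ω] (μ : Measure Ω) [IsProbabilityMeasure μ]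
        (α : ℕ → Fin L → ℝ) (A : ℕ → Fin L → Ω → Bool) (D : ℕ → Finset (Fin L))
        (σ : History L K → Ranking L K),
        IsEnvironment μ n α A → IsOptimalSets K n α D → IsCascadeSWUCB ε τ σ →
        (∀ a, (∃ t < n, a ∉ D t) → 0 < gap α D n a) →
        regret μ α A σ n ≤
          L * numChanges α n * τ + L * Real.log τ ^ 2 / logEta ε
            + ∑ a, swConst ε n τ (invGap α D n a) * (n * Real.log τ / τ)) ∧
    -- the limit of the constant
    (∀ (n τ : ℕ → ℕ) (g : ℕ → ℝ) (g₀ : ℝ),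
      Tendsto τ atTop atTop → Tendsto (fun k => (n k : ℝ) / τ k) atTop atTop →
      Tendsto g atTop (𝓝 g₀) →
      Tendsto (fun k => swConst ε (n k) (τ k) (g k)) atTop (𝓝 (2 / logEta ε + 8 * ε * g₀))) ∧
    -- the rate for the tuned window size, rounded to an integer in either direction
    (∀ δ : ℝ, 0 < δ → ∃ C : ℝ, ∀ (n τ : ℕ)
      (Ω : Type u) [MeasurableSpace Ω] (μ : Measure Ω) [IsProbabilityMeasure μ]
        (α : ℕ → Fin L → ℝ) (A : ℕ → Fin L → Ω → Bool) (D : ℕ → Finset (Fin L))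
        (σ : History L K → Ranking L K),
        IsEnvironment μ n α A → IsOptimalSets K n α D → IsCascadeSWUCB ε τ σ →
        (∀ t < n, ∀ a ∉ D t, ∀ b ∈ D t, δ ≤ α t b - α t a) →
        1 ≤ numChanges α n →
        |(τ : ℝ) - 2 * √(n * Real.log n / numChanges α n)| < 1 →
        regret μ α A σ n ≤ C * √(n * numChanges α n * Real.log n)) :=
  theorem2_general L K hK ε hε.1
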